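/- \textbf{Setting.} Let $\mathcal H$ and $V$ be real Hilbert spaces, $V$ continuously embedded in $\mathcal H$ with dense and compact inclusion; identify $\mathcal H$ with its dual, so that $V\subset\mathcal H\subset V^*$. Let $a:V\times V\to\mathbb R$ be a continuous bilinear form (not necessarily symmetric) that is semicoercive: there are $c>0$ and $\beta\in\mathbb R$ with $$a(y,y)\ \ge\ c\,\|y\|_V^2-\beta\,\|y\|_{\mathcal H}^2\qquad\text{for all }y\in V .$$ Let $A_V\in\mathcal L(V,V^*)$ be given by $\langle A_Vv,w\rangle=a(v,w)$, and let $A$ be the unbounded operator on $\mathcal H$ with $\operatorname{dom}(A)=\{v\in V:\ A_Vv\in\mathcal H\}$ and $Av=A_Vv$. Let $T>0$, $\Psi_0,\hat B_1,\Psi_{dT}\in\mathcal H$, $\hat B_2\in\mathcal L(\mathcal H)$, $f\in L^1(0,T;\mathcal H)$, $\Psi_d\in L^\infty(0,T;\mathcal H)$, $\alpha\in\mathbb R$, $u_m<u_M$ real, and let $q(y)=\langle Qy,y\rangle$, $q_T(y)=\langle Q_Ty,y\rangle$ with symmetric $Q,Q_T\in\mathcal L(\mathcal H,\mathcal H^*)$.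 \textbf{Theorem.} The operator $-A$ generates a strongly continuous semigroup $e^{-tA}$ on $\mathcal H$, and the following hold. (1) (Compactness hypothesis.) For $y_0\in\mathcal H$ and $g\in L^2(0,T;\mathcal H)$ let $$y[y_0,g](t)=e^{-tA}y_0+\int_0^te^{-(t-s)A}g(s)\,ds .$$ Then, for every $y_0\in\mathcal H$, the mapping $g\mapsto\hat B_2\,y[y_0,g]$ is compact (continuous, and bounded sets have relatively compact image) from $L^2(0,T;\mathcal H)$ to $L^2(0,T;\mathcal H)$. (2) (Existence of a minimum.) For each $u\in L^1(0,T)$ there is exactly one mild solution $\Psi[u]\in C([0,T];\mathcal H)$ of $\dot\Psi+A\Psi=f+u(\hat B_1+\hat B_2\Psi)$, $\Psi(0)=\Psi_0$, that is, of $$\Psi(t)=e^{-tA}\Psi_0+\int_0^te^{-(t-s)A}\big(f(s)+u(s)(\hat B_1+\hat B_2\Psi(s))\big)\,ds,\qquad t\in[0,T],$$ and the optimal control problem $$\min_{u}\ \ \alpha\int_0^Tu(t)\,dt+\tfrac12\int_0^Tq\big(\Psi[u](t)-\Psi_d(t)\big)\,dt+\tfrac12\,q_T\big(\Psi[u](T)-\Psi_{dT}\big)$$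 over all $u\in L^1(0,T)$ with $u_m\le u(t)\le u_M$ for a.e. $t\in[0,T]$ has at least one minimizer. -/

import Mathlib

open MeasureTheory Set Filter Topology
open scoped ENNReal

namespace ParabolicControl

/-! ### Bochner spaces on the time interval -/

/-- Lebesgue measure on `[0, T]`. -/
noncomputable abbrev timeMeasure (T : ℝ) : Measure ℝ := volume.restrict (Icc 0 T)

/-- The space `L^p(0, T; E)`. -/
abbrev LTime (E : Type*) [NormedAddCommGroup E] (p : ℝ≥0∞) (T : ℝ) : Type _ :=
  Lp E p (timeMeasure T)

/-! ### The Gelfand triple `V ⊂ H ⊂ V*` and the operator of a form -/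

section Form

variable {H V : Type*} [NormedAddCommGroup H] [InnerProductSpace ℝ H]
  [NormedAddCommGroup V] [InnerProductSpace ℝ V]

/-- `ι : V → H` is a continuous embedding with dense image, and the inclusion is compact. -/
structure IsDenseCompactEmbedding (ι : V →L[ℝ] H) : Prop where
  injective : Function.Injective ι
  denseRange : DenseRange ι
  compact : IsCompactOperator ι

/-- Semicoercivity of a form `a` on `V`: for some `c > 0` and `β ∈ ℝ`,
`a(y, y) ≥ c ‖y‖_V² - β ‖y‖_H²` for all `y ∈ V`. -/
def IsSemicoercive (ι : V →L[ℝ] H) (a : V →L[ℝ] V →L[ℝ] ℝ) : Prop :=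
  ∃ c : ℝ, 0 < c ∧ ∃ β : ℝ, ∀ y : V, c * ‖y‖ ^ 2 - β * ‖ι y‖ ^ 2 ≤ a y y

/-- The graph of the unbounded operator `A_H` on `H` induced by the form `a`.
Let `A_V : V → V*` be `v ↦ a(v, ·)`.  The domain of `A_H` consists of the `v ∈ V` (seen in `H`)
for which the functional `A_V v` lies in `H ⊂ V*`, that is, equals `(h, ·)_H` on `V` for some
`h ∈ H`, and then `A_H v = h`. -/
def FormOperatorGraph (ι : V →L[ℝ] H) (a : V →L[ℝ] V →L[ℝ] ℝ) (x h : H) : Prop :=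
  ∃ v : V, ι v = x ∧ ∀ w : V, a v w = inner ℝ h (ι w)

end Form

/-! ### Strongly continuous semigroups and mild solutions -/

/-- A strongly continuous semigroup `(S(t))_{t ≥ 0}` of bounded operators on `H`.  (Time is a real
variable; the values at negative times are irrelevant.) -/
structure C0Semigroup (H : Type*) [NormedAddCommGroup H] [NormedSpace ℝ H] where
  toFun : ℝ → H →L[ℝ] H
  map_zero : toFun 0 = ContinuousLinearMap.id ℝ H
  map_add : ∀ s t : ℝ, 0 ≤ s → 0 ≤ t → toFun (s + t) = (toFun s).comp (toFun t)
  continuousOn : ∀ x : H, ContinuousOn (fun t => toFun t x) (Ici 0)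

section Semigroup

variable {H : Type*} [NormedAddCommGroup H] [InnerProductSpace ℝ H]

/-- The semigroup `S` is `e^{-tA}`, where the unbounded operator `A` is given by its graph `G`:
`x` is in the domain of `A` with `A x = h` iff `(S(t) x - x) / t → -h` as `t ↓ 0`. -/
def C0Semigroup.IsGeneratedByNeg (S : C0Semigroup H) (G : H → H → Prop) : Prop :=
  ∀ x h : H, G x h ↔
    Tendsto (fun t : ℝ => t⁻¹ • (S.toFun t x - x)) (𝓝[>] 0) (𝓝 (-h))

/-- The mild solution `y[y₀, g]` of `y' + A y = g`, `y(0) = y₀`, where `S = e^{-tA}`: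
`y(t) = S(t) y₀ + ∫₀ᵗ S(t - s) g(s) ds`. -/
noncomputable def mildSolution (S : C0Semigroup H) (y₀ : H) (g : ℝ → H) (t : ℝ) : H :=
  S.toFun t y₀ + ∫ s in (0 : ℝ)..t, S.toFun (t - s) (g s)

/-- The compactness hypothesis: for every `y₀ ∈ H`, the mapping `g ↦ B₂ y[y₀, g]` is well defined
and compact (continuous, and mapping bounded sets to relatively compact sets) from
`L²(0, T; H)` to `L²(0, T; H)`. -/
def CompactnessHypothesis (S : C0Semigroup H) (B₂ : H →L[ℝ] H) (T : ℝ) : Prop :=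
  ∀ y₀ : H, ∃ Φ : LTime H 2 T → LTime H 2 T,
    (∀ g : LTime H 2 T, Φ g =ᵐ[timeMeasure T] fun t => B₂ (mildSolution S y₀ g t)) ∧
    Continuous Φ ∧
    ∀ K : Set (LTime H 2 T), Bornology.IsBounded K → IsCompact (closure (Φ '' K))

end Semigroup

/-! ### The bilinear optimal control problem -/

/-- The data of the optimal control problem on `[0, T]` with state space `H`, except for the
operator `A`. -/
structure ProblemData (H : Type*) [NormedAddCommGroup H] [InnerProductSpace ℝ H] (T : ℝ) where
  /-- initial state -/
  Ψ₀ : H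
  /-- source term, in `L¹(0, T; H)` -/
  f : LTime H 1 T
  B₁ : H
  B₂ : H →L[ℝ] H
  /-- symmetric operator `H → H*` of the quadratic form `q` of the running cost -/
  Q : H →L[ℝ] H →L[ℝ] ℝ
  Q_symm : ∀ x y, Q x y = Q y x
  /-- symmetric operator `H → H*` of the quadratic form `q_T` of the final cost -/
  QT : H →L[ℝ] H →L[ℝ] ℝ
  QT_symm : ∀ x y, QT x y = QT y x
  /-- running target, in `L^∞(0, T; H)` -/
  Ψd : LTime H ∞ T
  /-- final target -/
  ΨdT : H
  /-- weight of the control in the cost -/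
  α : ℝ
  /-- lower control bound -/
  um : ℝ
  /-- upper control bound -/
  uM : ℝ
  um_lt_uM : um < uM

namespace ProblemData

variable {H : Type*} [NormedAddCommGroup H] [InnerProductSpace ℝ H] {T : ℝ}

/-- `Ψ ∈ C([0, T]; H)` is a mild solution of the state equation
`Ψ' + A Ψ = f + u (B₁ + B₂ Ψ)`, `Ψ(0) = Ψ₀`, for the control `u ∈ L¹(0, T)`, where
`S = e^{-tA}`. -/
def IsState (D : ProblemData H T) (hT : 0 < T) (S : C0Semigroup H)
    (u : LTime ℝ 1 T) (Ψ : C(Icc (0 : ℝ) T, H)) : Prop :=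
  ∀ t : Icc (0 : ℝ) T, Ψ t =
    mildSolution S D.Ψ₀
      (fun s => D.f s + u s • (D.B₁ + D.B₂ (IccExtend hT.le Ψ s))) t

/-- The cost `J(u, Ψ) = α ∫₀ᵀ u + ½ ∫₀ᵀ q(Ψ(t) - Ψ_d(t)) dt + ½ q_T(Ψ(T) - Ψ_{dT})`, with
`q(y) = ⟨Q y, y⟩` and `q_T(y) = ⟨Q_T y, y⟩`. -/
noncomputable def cost (D : ProblemData H T) (hT : 0 < T)
    (u : LTime ℝ 1 T) (Ψ : C(Icc (0 : ℝ) T, H)) : ℝ :=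
  D.α * (∫ t, u t ∂(timeMeasure T)) +
    1 / 2 * (∫ t, D.Q (IccExtend hT.le Ψ t - D.Ψd t) (IccExtend hT.le Ψ t - D.Ψd t)
      ∂(timeMeasure T)) +
    1 / 2 * D.QT (IccExtend hT.le Ψ T - D.ΨdT) (IccExtend hT.le Ψ T - D.ΨdT)

/-- The feasible controls: `u ∈ L¹(0, T)` with `u_m ≤ u(t) ≤ u_M` for a.e. `t ∈ [0, T]`. -/
def feasible (D : ProblemData H T) : Set (LTime ℝ 1 T) :=
  {u | ∀ᵐ t ∂(timeMeasure T), D.um ≤ u t ∧ u t ≤ D.uM}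

/-- The control problem is well posed and has a nonempty set of minima: the control-to-state map
`u ↦ Ψ[u]` is defined on `L¹(0, T)` (for each `u` there is exactly one mild solution `Ψ[u]`), and
the reduced cost `F(u) = J(u, Ψ[u])` attains its minimum over the feasible controls. -/
def HasMinimum (D : ProblemData H T) (hT : 0 < T) (S : C0Semigroup H) : Prop :=
  ∃ stateMap : LTime ℝ 1 T → C(Icc (0 : ℝ) T, H),
    (∀ u Ψ, D.IsState hT S u Ψ ↔ Ψ = stateMap u) ∧
    ∃ û ∈ D.feasible, ∀ u ∈ D.feasible,
      D.cost hT û (stateMap û) ≤ D.cost hT u (stateMap u)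

end ProblemData

end ParabolicControl

namespace ParabolicControl

/-! ### Exponentials of bounded dissipative operators -/

section Dissipative

variable {H : Type*} [NormedAddCommGroup H] [InnerProductSpace ℝ H] [CompleteSpace H]

/-! Generation. With the shift `β`, Lax-Milgram inverts `l + β + A` for every `l > 0`, and
semicoercivity gives the resolvent norm at most `1 / l`. So `A + β` satisfies the Hille-Yosida
conditions (`exists_hasContractiveResolvent`). The semigroup is the limit of exponentials of Yosida
approximations (`exists_c0Semigroup`), and rescaling by `e^{βt}` removes the shift.

Compactness. The energy identity bounds the time integral of the squared `V`-norm along trajectories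
starting in the domain. Hence, for a bounded sequence of such initial values, a subsequence is
bounded in `V` at some time `s ≤ t`. The compact embedding and `S(t - s)` then show that `S(t)` is
compact for `t > 0` (`isCompact_closure_image_semigroup`). Cutting a short final piece off the
Duhamel integral leaves `S(δ)` applied to a bounded vector, so Arzelà-Ascoli makes the Duhamel
operator compact from `L²(0,T;H)` to `C([0,T];H)` (`exists_isCompact_duhamelMap_mem`). This gives
(1) by composition with a continuous map.

Minimum. States exist and are unique by contraction in an exponentially weighted sup norm. Feasible
controls are relatively compact weakly in `L²`, and their states lie in one compact set of
`C([0,T];H)`. Weak convergence of controls together with uniform convergence of states passes to the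
limit in the bilinear term (`isState_of_tendsto`) and in the cost (`tendsto_cost`). The reduced cost
therefore has compact image on the feasible set. No sign of `Q` or `Q_T` is needed, since the state
converges strongly. -/

lemma hasDerivAt_exp_smul_apply (P : H →L[ℝ] H) (x : H) (t : ℝ) :
    HasDerivAt (fun s : ℝ => NormedSpace.exp (s • P) x) (NormedSpace.exp (t • P) (P x)) t := by
  simpa using (hasDerivAt_exp_smul_const (𝕂 := ℝ) P t).clm_apply (hasDerivAt_const t x)

lemma hasDerivAt_exp_smul_apply' (P : H →L[ℝ] H) (x : H) (t : ℝ) :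
    HasDerivAt (fun s : ℝ => NormedSpace.exp (s • P) x) (P (NormedSpace.exp (t • P) x)) t := by
  simpa using (hasDerivAt_exp_smul_const' (𝕂 := ℝ) P t).clm_apply (hasDerivAt_const t x)

/-- The derivative of `‖e^{sP} x‖²` is twice the dissipativity pairing at `e^{sP} x`, so it is
nonpositive. -/
lemma norm_exp_apply_le_of_dissipative {P : H →L[ℝ] H} (hP : ∀ x, inner ℝ (P x) x ≤ 0) (x : H) :
    ‖NormedSpace.exp P x‖ ≤ ‖x‖ := by
  have hd (t : ℝ) := (hasDerivAt_exp_smul_apply' P x t).norm_sq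
  have hanti : Antitone (fun s : ℝ => ‖NormedSpace.exp (s • P) x‖ ^ 2) := by
    refine antitone_of_deriv_nonpos (fun t => (hd t).differentiableAt) fun t => ?_
    rw [(hd t).deriv, real_inner_comm]
    linarith [hP (NormedSpace.exp (t • P) x)]
  have h := hanti zero_le_one
  simp only [one_smul, zero_smul, NormedSpace.exp_zero] at h
  exact le_of_sq_le_sq h (norm_nonneg x)

omit [CompleteSpace H] in
lemma inner_smul_add_smul_nonpos {P Q : H →L[ℝ] H} (hP : ∀ x, inner ℝ (P x) x ≤ 0)
    (hQ : ∀ x, inner ℝ (Q x) x ≤ 0) {s t : ℝ} (hs : 0 ≤ s) (ht : 0 ≤ t) (x : H) :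
    inner ℝ ((s • P + t • Q) x) x ≤ 0 := by
  simp only [add_apply, smul_apply, inner_add_left,
    inner_smul_left, RCLike.conj_to_real]
  nlinarith [mul_nonneg hs (neg_nonneg.2 (hP x)), mul_nonneg ht (neg_nonneg.2 (hQ x))]

lemma norm_exp_smul_apply_le {P : H →L[ℝ] H} (hP : ∀ x, inner ℝ (P x) x ≤ 0) {t : ℝ}
    (ht : 0 ≤ t) (x : H) : ‖NormedSpace.exp (t • P) x‖ ≤ ‖x‖ :=
  norm_exp_apply_le_of_dissipative
    (fun y => by simpa using inner_smul_add_smul_nonpos hP hP ht le_rfl y) x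

/-- Because `P` and `Q` commute, `s ↦ e^{sP + (t-s)Q} x` joins the two vectors and has derivative
`e^{sP + (t-s)Q} (P - Q) x`. The exponent is dissipative for `s` in `[0, t]`, so the speed is at
most `‖P x - Q x‖`. -/
lemma norm_exp_smul_apply_sub_le {P Q : H →L[ℝ] H} (hP : ∀ x, inner ℝ (P x) x ≤ 0)
    (hQ : ∀ x, inner ℝ (Q x) x ≤ 0) (hPQ : Commute P Q) {t : ℝ} (ht : 0 ≤ t) (x : H) :
    ‖NormedSpace.exp (t • P) x - NormedSpace.exp (t • Q) x‖ ≤ t * ‖P x - Q x‖ := by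
  have key (s : ℝ) : NormedSpace.exp (t • Q) * NormedSpace.exp (s • (P - Q)) =
      NormedSpace.exp (s • P + (t - s) • Q) := by
    let _ : NormedAlgebra ℚ (H →L[ℝ] H) := NormedAlgebra.restrictScalars ℚ ℝ _
    rw [← NormedSpace.exp_add_of_commute]
    · congr 1; module
    · exact ((hPQ.symm.sub_right (Commute.refl Q)).smul_left t).smul_right s
  have h := norm_image_sub_le_of_norm_deriv_le_segment' (a := 0) (b := t) (C := ‖P x - Q x‖)
    (f := fun s => NormedSpace.exp (t • Q) (NormedSpace.exp (s • (P - Q)) x))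
    (f' := fun s => NormedSpace.exp (t • Q) (NormedSpace.exp (s • (P - Q)) ((P - Q) x)))
    (fun s _ => ((NormedSpace.exp (t • Q)).hasFDerivAt.comp_hasDerivAt s
      (hasDerivAt_exp_smul_apply (P - Q) x s)).hasDerivWithinAt)
    (fun s hs => by
      rw [← mul_apply_eq_comp, key]
      exact norm_exp_apply_le_of_dissipative
        (inner_smul_add_smul_nonpos hP hQ hs.1 (sub_nonneg.2 hs.2.le)) _)
    t (right_mem_Icc.2 ht)
  simp only [← mul_apply_eq_comp, key] at h
  simpa [mul_comm] using h

lemma norm_exp_smul_apply_sub_le_of_time {P : H →L[ℝ] H} (hP : ∀ x, inner ℝ (P x) x ≤ 0)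
    {s t : ℝ} (hs : 0 ≤ s) (hst : s ≤ t) (x : H) :
    ‖NormedSpace.exp (t • P) x - NormedSpace.exp (s • P) x‖ ≤ (t - s) * ‖P x‖ := by
  have h := norm_image_sub_le_of_norm_deriv_le_segment' (a := s) (b := t) (C := ‖P x‖)
    (fun r _ => (hasDerivAt_exp_smul_apply P x r).hasDerivWithinAt)
    (fun r hr => norm_exp_smul_apply_le hP (hs.trans hr.1) _) t (right_mem_Icc.2 hst)
  simpa [mul_comm] using h

/-- The first-order remainder has derivative `e^{rP} P x - P x`. Comparing `P x` with an auxiliary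
`k` keeps `P² x` out of the bound. For Yosida approximations only `P x` and `P k` then have to
converge, which holds when `x` and `k` are in the domain. -/
lemma norm_exp_smul_apply_sub_sub_le {P : H →L[ℝ] H} (hP : ∀ x, inner ℝ (P x) x ≤ 0)
    {t : ℝ} (ht : 0 ≤ t) (x k : H) :
    ‖NormedSpace.exp (t • P) x - x - t • P x‖ ≤ t * (2 * ‖P x - k‖ + t * ‖P k‖) := by
  have h := norm_image_sub_le_of_norm_deriv_le_segment' (a := 0) (b := t)
    (C := 2 * ‖P x - k‖ + t * ‖P k‖)
    (fun r _ => ((hasDerivAt_exp_smul_apply P x r).sub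
      ((hasDerivAt_id r).smul_const (P x))).hasDerivWithinAt)
    (fun r hr => by
      have h1 := norm_exp_smul_apply_le hP hr.1 (P x - k)
      have h2 := norm_exp_smul_apply_sub_le_of_time hP le_rfl hr.1 k
      simp only [zero_smul, NormedSpace.exp_zero, one_apply_eq_self, sub_zero] at h2
      have h3 : r * ‖P k‖ ≤ t * ‖P k‖ := by gcongr; exact hr.2.le
      have h4 : NormedSpace.exp (r • P) (P x) - (1 : ℝ) • P x = NormedSpace.exp (r • P) (P x - k)
          + (NormedSpace.exp (r • P) k - k) - (P x - k) := by simp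
      rw [h4]
      refine (norm_sub_le _ _).trans ?_
      linarith [norm_add_le (NormedSpace.exp (r • P) (P x - k)) (NormedSpace.exp (r • P) k - k)])
    t (right_mem_Icc.2 ht)
  simp only [Pi.sub_apply, id, zero_smul, NormedSpace.exp_zero, one_apply_eq_self,
    sub_zero] at h
  rw [mul_comm t]
  convert h using 2
  abel

end Dissipative

/-! ### The Hille-Yosida theorem for contraction semigroups -/

section HilleYosida

variable {H : Type*} [NormedAddCommGroup H] [InnerProductSpace ℝ H]

omit [InnerProductSpace ℝ H] in
lemma exists_mem_norm_sub_lt_of_dense {D : Set H} (hD : Dense D) (x : H) {ε : ℝ} (hε : 0 < ε) :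
    ∃ y ∈ D, ‖x - y‖ < ε := by
  obtain ⟨y, hy, h⟩ := hD.exists_dist_lt x hε
  exact ⟨y, hy, by rwa [← dist_eq_norm]⟩

/-- The operator with graph `G` is densely defined, and `R l = (l + A)⁻¹` is a bounded operator of
norm at most `1 / l`, for all `l > 0`. -/
structure HasContractiveResolvent (G : H → H → Prop) (R : ℝ → H →L[ℝ] H) : Prop where
  norm_le : ∀ l : ℝ, 0 < l → ∀ x, ‖R l x‖ ≤ l⁻¹ * ‖x‖
  graph_iff : ∀ l : ℝ, 0 < l → ∀ x h, G x h ↔ R l (l • x + h) = x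
  dense : Dense {x | ∃ h, G x h}

/-- The Yosida approximation `l² R l - l` of `-A`. -/
noncomputable def yosida (R : ℝ → H →L[ℝ] H) (l : ℝ) : H →L[ℝ] H :=
  l ^ 2 • R l - l • ContinuousLinearMap.id ℝ H

lemma yosida_apply (R : ℝ → H →L[ℝ] H) (l : ℝ) (x : H) :
    yosida R l x = l ^ 2 • R l x - l • x := rfl

namespace HasContractiveResolvent

variable {G : H → H → Prop} {R : ℝ → H →L[ℝ] H}

lemma graph_resolvent (hR : HasContractiveResolvent G R) {l : ℝ} (hl : 0 < l) (y : H) :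
    G (R l y) (y - l • R l y) := by
  rw [hR.graph_iff l hl]; simp

lemma resolvent_identity (hR : HasContractiveResolvent G R) {l m : ℝ} (hl : 0 < l) (hm : 0 < m)
    (y : H) : R m y = R l y + (l - m) • R l (R m y) := by
  have h := (hR.graph_iff l hl _ _).1 (hR.graph_resolvent hm y)
  rw [map_add, map_sub, map_smul, map_smul] at h
  nth_rewrite 1 [← h]
  module

/-- Adding the resolvent identity to its copy with `l` and `m` exchanged leaves `l - m` times the
commutator equal to zero. -/
lemma commute (hR : HasContractiveResolvent G R) {l m : ℝ} (hl : 0 < l) (hm : 0 < m) :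
    Commute (R l) (R m) := by
  rcases eq_or_ne l m with rfl | hlm
  · exact Commute.refl _
  ext y
  have h1 := hR.resolvent_identity hl hm y
  have h2 := hR.resolvent_identity hm hl y
  have h3 : (l - m) • (R l (R m y) - R m (R l y)) = 0 := by
    have : (l - m) • (R l (R m y) - R m (R l y)) =
      (R l y + (l - m) • R l (R m y)) + (R m y + (m - l) • R m (R l y)) - R l y - R m y := by
      module
    rw [this, ← h1, ← h2]; abel
  exact sub_eq_zero.1 ((smul_eq_zero.1 h3).resolve_left (sub_ne_zero.2 hlm))

lemma commute_yosida (hR : HasContractiveResolvent G R) {l m : ℝ} (hl : 0 < l) (hm : 0 < m) :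
    Commute (yosida R l) (yosida R m) := by
  have h1 (P : H →L[ℝ] H) (c : ℝ) : Commute P (c • ContinuousLinearMap.id ℝ H) :=
    (Commute.one_right P).smul_right c
  exact ((((hR.commute hl hm).smul_left _).smul_right _).sub_right (h1 _ _)).sub_left
    (((h1 _ _).symm).sub_right (h1 _ _))

lemma inner_yosida_nonpos (hR : HasContractiveResolvent G R) {l : ℝ} (hl : 0 < l) (x : H) :
    inner ℝ (yosida R l x) x ≤ 0 := by
  have h1 := (real_inner_le_norm (R l x) x).trans
    (mul_le_mul_of_nonneg_right (hR.norm_le l hl x) (norm_nonneg x))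
  have h2 : l ^ 2 * (l⁻¹ * ‖x‖ * ‖x‖) = l * (‖x‖ * ‖x‖) := by field_simp
  rw [yosida_apply, inner_sub_left, inner_smul_left, inner_smul_left, real_inner_self_eq_norm_sq]
  simp only [RCLike.conj_to_real]
  nlinarith [mul_le_mul_of_nonneg_left h1 (sq_nonneg l)]

lemma norm_smul_resolvent_sub_le (hR : HasContractiveResolvent G R) {l : ℝ} (hl : 0 < l) {x h : H}
    (hx : G x h) (y : H) : ‖l • R l y - y‖ ≤ 2 * ‖y - x‖ + l⁻¹ * ‖h‖ := by
  have h1 := (hR.graph_iff l hl _ _).1 hx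
  have h2 : l • R l y - y = l • R l (y - x) - (y - x) - R l h := by
    have : l • R l x = x - R l h := by
      rw [eq_sub_iff_add_eq, ← map_smul, ← map_add, h1]
    rw [map_sub, smul_sub, this]; abel
  have h3 : ‖l • R l (y - x)‖ ≤ ‖y - x‖ := by
    rw [norm_smul, Real.norm_of_nonneg hl.le]
    calc l * ‖R l (y - x)‖ ≤ l * (l⁻¹ * ‖y - x‖) := by gcongr; exact hR.norm_le l hl _
      _ = ‖y - x‖ := by field_simp
  rw [h2]
  linarith [norm_sub_le (l • R l (y - x) - (y - x)) (R l h),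
    norm_sub_le (l • R l (y - x)) (y - x), hR.norm_le l hl h]

lemma tendsto_smul_resolvent (hR : HasContractiveResolvent G R) (y : H) :
    Tendsto (fun l => l • R l y) atTop (𝓝 y) := by
  rw [Metric.tendsto_nhds]
  intro ε hε
  obtain ⟨x, ⟨h, hx⟩, hxy⟩ := exists_mem_norm_sub_lt_of_dense hR.dense y (show 0 < ε / 4 by linarith)
  have h1 : Tendsto (fun l : ℝ => l⁻¹ * ‖h‖) atTop (𝓝 0) := by
    simpa using tendsto_inv_atTop_zero.mul_const ‖h‖
  filter_upwards [h1.eventually_lt_const (show 0 < ε / 2 by linarith), eventually_gt_atTop 0]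
    with l hl hl0
  rw [dist_eq_norm]
  linarith [hR.norm_smul_resolvent_sub_le hl0 hx y]

/-- On the domain the Yosida approximation is `-l R_l h`, and `l R_l` tends strongly to the
identity. -/
lemma tendsto_yosida (hR : HasContractiveResolvent G R) {x h : H} (hx : G x h) :
    Tendsto (fun l => yosida R l x) atTop (𝓝 (-h)) := by
  refine ((hR.tendsto_smul_resolvent h).neg).congr' ?_
  filter_upwards [eventually_gt_atTop 0] with l hl
  have h1 := (hR.graph_iff l hl _ _).1 hx
  have h2 : R l h = x - l • R l x := by
    rw [eq_sub_iff_add_eq', ← map_smul, ← map_add, h1]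
  rw [yosida_apply, h2]
  module

lemma tendsto_yosida_nat (hR : HasContractiveResolvent G R) {x h : H} (hx : G x h) :
    Tendsto (fun n : ℕ => yosida R (n + 1) x) atTop (𝓝 (-h)) :=
  (hR.tendsto_yosida hx).comp (tendsto_atTop_add_const_right _ _ tendsto_natCast_atTop_atTop)

variable [CompleteSpace H]

/-- On a domain vector, commuting exponentials differ by at most `t` times the difference of the
generators, which is Cauchy. Density and contractivity extend this to all vectors. -/
lemma cauchySeq_exp_yosida (hR : HasContractiveResolvent G R) {t : ℝ} (ht : 0 ≤ t) (x : H) :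
    CauchySeq (fun n : ℕ => NormedSpace.exp (t • yosida R (n + 1)) x) := by
  have hd (n : ℕ) := fun x => hR.inner_yosida_nonpos (n.cast_add_one_pos (α := ℝ)) x
  rw [Metric.cauchySeq_iff']
  intro ε hε
  obtain ⟨y, ⟨h, hy⟩, hxy⟩ := exists_mem_norm_sub_lt_of_dense hR.dense x (show 0 < ε / 4 by linarith)
  obtain ⟨N, hN⟩ := Metric.cauchySeq_iff'.1 (hR.tendsto_yosida_nat hy).cauchySeq
    (ε / (2 * (t + 1))) (by positivity)
  refine ⟨N, fun n hn => ?_⟩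
  have h1 := norm_exp_smul_apply_sub_le (hd n) (hd N)
    (hR.commute_yosida n.cast_add_one_pos N.cast_add_one_pos) ht y
  have h2 := hN n hn
  rw [dist_eq_norm] at h2 ⊢
  have h3 : t * ‖yosida R (n + 1) y - yosida R (N + 1) y‖ ≤ ε / 2 := by
    calc t * ‖yosida R (n + 1) y - yosida R (N + 1) y‖ ≤ (t + 1) * (ε / (2 * (t + 1))) := by
          gcongr; linarith
      _ = ε / 2 := by field_simp
  have h4 (n : ℕ) := norm_exp_smul_apply_le (hd n) ht (x - y)
  have h5 : NormedSpace.exp (t • yosida R (n + 1)) x - NormedSpace.exp (t • yosida R (N + 1)) x =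
      NormedSpace.exp (t • yosida R (n + 1)) (x - y) +
      (NormedSpace.exp (t • yosida R (n + 1)) y - NormedSpace.exp (t • yosida R (N + 1)) y) -
      NormedSpace.exp (t • yosida R (N + 1)) (x - y) := by
    simp only [map_sub]; abel
  rw [h5]
  refine (norm_sub_le _ _).trans_lt ?_
  linarith [norm_add_le (NormedSpace.exp (t • yosida R (n + 1)) (x - y))
    (NormedSpace.exp (t • yosida R (n + 1)) y - NormedSpace.exp (t • yosida R (N + 1)) y),
    h4 n, h4 N]

/-- The condition `0 ≤ t` sits inside the existential so that `choose` yields an operator for every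
real time; at negative times it is zero. -/
lemma exists_tendsto_exp_yosida (hR : HasContractiveResolvent G R) (t : ℝ) :
    ∃ L : H →L[ℝ] H, 0 ≤ t →
      ∀ x, Tendsto (fun n : ℕ => NormedSpace.exp (t • yosida R (n + 1)) x) atTop (𝓝 (L x)) := by
  by_cases ht : 0 ≤ t
  · choose f hf using fun x => cauchySeq_tendsto_of_complete (hR.cauchySeq_exp_yosida ht x)
    exact ⟨continuousLinearMapOfTendsto _ (tendsto_pi_nhds.2 hf), fun _ => hf⟩
  · exact ⟨0, fun h => absurd h ht⟩

/-- **Hille-Yosida theorem** for contraction semigroups on Hilbert spaces. -/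
theorem exists_c0Semigroup (hR : HasContractiveResolvent G R) :
    ∃ S : C0Semigroup H, S.IsGeneratedByNeg G := by
  have hd (n : ℕ) := fun x => hR.inner_yosida_nonpos (n.cast_add_one_pos (α := ℝ)) x
  choose L hL using hR.exists_tendsto_exp_yosida
  have hcontr (t : ℝ) (ht : 0 ≤ t) (x : H) : ‖L t x‖ ≤ ‖x‖ :=
    le_of_tendsto' (hL t ht x).norm fun n => norm_exp_smul_apply_le (hd n) ht x
  have hzero : L 0 = ContinuousLinearMap.id ℝ H := by
    ext x
    have h := hL 0 le_rfl x
    simp only [zero_smul, NormedSpace.exp_zero, one_apply_eq_self] at h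
    exact tendsto_nhds_unique h tendsto_const_nhds
  have hadd (s t : ℝ) (hs : 0 ≤ s) (ht : 0 ≤ t) : L (s + t) = (L s).comp (L t) := by
    ext x
    refine tendsto_nhds_unique (hL (s + t) (add_nonneg hs ht) x) ?_
    have h1 : Tendsto (fun n : ℕ => NormedSpace.exp (s • yosida R (n + 1))
        (NormedSpace.exp (t • yosida R (n + 1)) x - L t x)) atTop (𝓝 0) :=
      squeeze_zero_norm (fun n => norm_exp_smul_apply_le (hd n) hs _)
        (tendsto_iff_norm_sub_tendsto_zero.1 (hL t ht x))
    have h2 := h1.add (hL s hs (L t x))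
    rw [zero_add] at h2
    refine h2.congr fun n => ?_
    let _ : NormedAlgebra ℚ (H →L[ℝ] H) := NormedAlgebra.restrictScalars ℚ ℝ _
    rw [add_smul, NormedSpace.exp_add_of_commute
      (((Commute.refl (yosida R (n + 1))).smul_left s).smul_right t)]
    simp
  have hlip {x h : H} (hx : G x h) {s t : ℝ} (hs : 0 ≤ s) (hst : s ≤ t) :
      ‖L t x - L s x‖ ≤ (t - s) * ‖h‖ := by
    rw [← norm_neg h]
    exact le_of_tendsto_of_tendsto' ((hL t (hs.trans hst) x).sub (hL s hs x)).norm
      ((hR.tendsto_yosida_nat hx).norm.const_mul _)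
      fun n => norm_exp_smul_apply_sub_le_of_time (hd n) hs hst x
  have hcont (x : H) : ContinuousOn (fun t => L t x) (Ici 0) := by
    rw [Metric.continuousOn_iff]
    intro s hs ε hε
    obtain ⟨y, ⟨h, hy⟩, hxy⟩ :=
      exists_mem_norm_sub_lt_of_dense hR.dense x (show 0 < ε / 4 by linarith)
    refine ⟨ε / (2 * (‖h‖ + 1)), by positivity, fun t ht hts => ?_⟩
    have h1 : ‖L t y - L s y‖ ≤ |t - s| * ‖h‖ := by
      rcases le_total s t with hst | hst
      · exact (hlip hy hs hst).trans_eq (by rw [abs_of_nonneg (sub_nonneg.2 hst)])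
      · rw [norm_sub_rev, abs_sub_comm]
        exact (hlip hy ht hst).trans_eq (by rw [abs_of_nonneg (sub_nonneg.2 hst)])
    have h2 : |t - s| * ‖h‖ ≤ ε / 2 := by
      rw [Real.dist_eq] at hts
      calc |t - s| * ‖h‖ ≤ (ε / (2 * (‖h‖ + 1))) * (‖h‖ + 1) := by gcongr; linarith
        _ = ε / 2 := by field_simp
    have h5 : L t x - L s x = L t (x - y) + (L t y - L s y) - L s (x - y) := by
      simp only [map_sub]; abel
    rw [dist_eq_norm, h5]
    refine (norm_sub_le _ _).trans_lt ?_
    linarith [norm_add_le (L t (x - y)) (L t y - L s y), hcontr t ht (x - y), hcontr s hs (x - y)]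
  have hest {x h : H} (hx : G x h) {k k' : H} (hk : G k k') {t : ℝ} (ht : 0 ≤ t) :
      ‖L t x - x - t • (-h)‖ ≤ t * (2 * ‖-h - k‖ + t * ‖-k'‖) :=
    le_of_tendsto_of_tendsto'
      (((hL t ht x).sub_const x).sub ((hR.tendsto_yosida_nat hx).const_smul t)).norm
      (((((hR.tendsto_yosida_nat hx).sub_const k).norm.const_mul 2).add
        ((hR.tendsto_yosida_nat hk).norm.const_mul t)).const_mul t)
      fun n => norm_exp_smul_apply_sub_sub_le (hd n) ht x k
  have hgen {x h : H} (hx : G x h) :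
      Tendsto (fun t : ℝ => t⁻¹ • (L t x - x)) (𝓝[>] 0) (𝓝 (-h)) := by
    rw [Metric.tendsto_nhds]
    intro ε hε
    obtain ⟨k, ⟨k', hk⟩, hkh⟩ :=
      exists_mem_norm_sub_lt_of_dense hR.dense (-h) (show 0 < ε / 4 by linarith)
    have h1 : Tendsto (fun t : ℝ => t * ‖-k'‖) (𝓝[>] 0) (𝓝 0) := by
      have : Tendsto (fun t : ℝ => t * ‖-k'‖) (𝓝 0) (𝓝 (0 * ‖-k'‖)) :=
        (continuous_id.mul continuous_const).tendsto 0
      rw [zero_mul] at this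
      exact this.mono_left nhdsWithin_le_nhds
    filter_upwards [h1.eventually_lt_const (show 0 < ε / 2 by linarith), self_mem_nhdsWithin]
      with t ht ht0
    have ht0' : 0 < t := ht0
    have h2 : t⁻¹ • (L t x - x) - -h = t⁻¹ • (L t x - x - t • (-h)) := by
      rw [smul_sub t⁻¹ (L t x - x), smul_smul, inv_mul_cancel₀ ht0'.ne', one_smul]
    rw [dist_eq_norm, h2, norm_smul, norm_inv, Real.norm_of_nonneg ht0'.le, inv_mul_lt_iff₀ ht0']
    refine (hest hx hk ht0'.le).trans_lt ?_
    gcongr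
    linarith
  refine ⟨⟨L, hzero, hadd, hcont⟩, fun x h => ⟨hgen, fun hx => ?_⟩⟩
  -- The generator has no larger domain than `G`: `z` lies in the domain of `G` and solves the same
  -- equation `z + A z = x + h`. The difference quotients of `x - z` then tend to `x - z`, while
  -- contractivity makes their inner products with `x - z` nonpositive. So `x = z`.
  have hz := hR.graph_resolvent one_pos (x + h)
  set z := R 1 (x + h) with hz_def
  have h1 := hx.sub (hgen hz)
  have h2 : Tendsto (fun t : ℝ => inner ℝ (t⁻¹ • (L t (x - z) - (x - z))) (x - z))
      (𝓝[>] 0) (𝓝 (inner ℝ (x - z) (x - z))) := by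
    refine Tendsto.inner ?_ tendsto_const_nhds
    have h3 : -h - -(x + h - (1 : ℝ) • z) = x - z := by rw [one_smul]; abel
    rw [h3] at h1
    refine h1.congr fun t => ?_
    rw [← smul_sub]; simp only [map_sub]; congr 1; abel
  have h3 : inner ℝ (x - z) (x - z) ≤ 0 := by
    refine le_of_tendsto h2 ?_
    filter_upwards [self_mem_nhdsWithin] with t ht
    have ht' : 0 < t := ht
    rw [inner_smul_left, inner_sub_left, real_inner_self_eq_norm_sq]
    have h4 := (real_inner_le_norm (L t (x - z)) (x - z)).trans
      (mul_le_mul_of_nonneg_right (hcontr t ht'.le _) (norm_nonneg _))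
    exact mul_nonpos_of_nonneg_of_nonpos (by simpa using ht'.le) (by nlinarith)
  have h4 : x = z := by
    rw [real_inner_self_eq_norm_sq] at h3
    exact sub_eq_zero.1 (norm_eq_zero.1 (pow_eq_zero_iff two_ne_zero |>.1
      (le_antisymm h3 (sq_nonneg _))))
  rw [← h4] at hz
  simpa using hz

end HasContractiveResolvent

end HilleYosida

/-! ### Rescaling of semigroups -/

section Rescale

variable {H : Type*} [NormedAddCommGroup H] [InnerProductSpace ℝ H]

/-- The semigroup `e^{b t} S(t)`. -/
noncomputable def C0Semigroup.rescale (S : C0Semigroup H) (b : ℝ) : C0Semigroup H where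
  toFun t := Real.exp (b * t) • S.toFun t
  map_zero := by simp [S.map_zero]
  map_add s t hs ht := by
    ext x
    simp [S.map_add s t hs ht, mul_add, Real.exp_add, smul_smul, mul_comm]
  continuousOn x := by
    have h : Continuous fun t : ℝ => Real.exp (b * t) := by fun_prop
    exact h.continuousOn.smul (S.continuousOn x)

lemma tendsto_slope_exp_smul {F : ℝ → H} {x y : H} (b : ℝ)
    (h : Tendsto (fun t : ℝ => t⁻¹ • (F t - x)) (𝓝[>] 0) (𝓝 y)) :
    Tendsto (fun t : ℝ => t⁻¹ • (Real.exp (b * t) • F t - x)) (𝓝[>] 0) (𝓝 (y + b • x)) := by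
  have h1 : Tendsto (fun t : ℝ => Real.exp (b * t)) (𝓝[>] 0) (𝓝 1) := by
    have : Continuous fun t : ℝ => Real.exp (b * t) := by fun_prop
    simpa using (this.tendsto 0).mono_left nhdsWithin_le_nhds
  have h2 : Tendsto (fun t : ℝ => t⁻¹ * (Real.exp (b * t) - 1)) (𝓝[>] 0) (𝓝 b) := by
    have hd : HasDerivAt (fun t : ℝ => Real.exp (b * t)) b 0 := by
      simpa using ((hasDerivAt_id (0 : ℝ)).const_mul b).exp
    simpa using hd.tendsto_slope_zero_right
  have h3 := (h1.smul h).add (h2.smul_const x)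
  rw [one_smul] at h3
  refine h3.congr fun t => ?_
  module

lemma C0Semigroup.IsGeneratedByNeg.rescale {S : C0Semigroup H} {G : H → H → Prop}
    (hS : S.IsGeneratedByNeg G) (b : ℝ) :
    (S.rescale b).IsGeneratedByNeg fun x h => G x (h + b • x) := by
  intro x h
  refine (hS x (h + b • x)).trans ?_
  constructor
  · intro h1
    have h2 := tendsto_slope_exp_smul b h1
    rwa [neg_add, neg_add_cancel_right] at h2
  -- Rescaling back by `-b` reduces the converse to the same limit.
  · intro h1
    have h2 := tendsto_slope_exp_smul (-b) h1
    rw [neg_smul, ← neg_add] at h2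
    refine h2.congr fun t => ?_
    simp only [C0Semigroup.rescale, smul_apply, smul_smul]
    rw [← Real.exp_add]; simp

end Rescale

/-! ### The operator of a semicoercive form -/

section Form

variable {H V : Type*} [NormedAddCommGroup H] [InnerProductSpace ℝ H] [CompleteSpace H]
  [NormedAddCommGroup V] [InnerProductSpace ℝ V] [CompleteSpace V]
  {ι : V →L[ℝ] H} {a : V →L[ℝ] V →L[ℝ] ℝ} {c β : ℝ}

/-- Adding `β + l` times the `H` inner product makes the form coercive with constant `c`.
Lax-Milgram supplies the inverse, composed with `ι` on the left and its adjoint on the right. -/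
lemma exists_resolvent_of_semicoercive (hc : 0 < c)
    (ha : ∀ y : V, c * ‖y‖ ^ 2 - β * ‖ι y‖ ^ 2 ≤ a y y) {l : ℝ} (hl : 0 < l) :
    ∃ R : H →L[ℝ] H, ∀ y, ∃ v, R y = ι v ∧
      ∀ w, a v w + (β + l) * inner ℝ (ι v) (ι w) = inner ℝ y (ι w) := by
  obtain ⟨I, hI⟩ : ∃ I : H →L[ℝ] H →L[ℝ] ℝ, ∀ x y, I x y = inner ℝ x y :=
    ⟨innerSL ℝ, fun _ _ => rfl⟩
  have hB : IsCoercive (a + (β + l) • I.bilinearComp ι ι) := by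
    refine ⟨c, hc, fun u => ?_⟩
    have h1 : (a + (β + l) • I.bilinearComp ι ι) u u =
        a u u + (β + l) * ‖ι u‖ ^ 2 := by simp [hI]
    rw [h1]
    nlinarith [ha u, mul_nonneg hl.le (sq_nonneg ‖ι u‖)]
  refine ⟨ι ∘L (hB.continuousLinearEquivOfBilin.symm : V →L[ℝ] V) ∘L ι.adjoint,
    fun y => ⟨hB.continuousLinearEquivOfBilin.symm (ι.adjoint y), rfl, fun w => ?_⟩⟩
  have h := hB.continuousLinearEquivOfBilin_apply
    (hB.continuousLinearEquivOfBilin.symm (ι.adjoint y)) w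
  rw [ContinuousLinearEquiv.apply_symm_apply, ContinuousLinearMap.adjoint_inner_left] at h
  simpa [hI] using h.symm

/-- The graph is that of `A + β`. The norm bound comes from testing the weak equation with its own
solution, and uniqueness from testing the difference of two solutions with itself. -/
lemma exists_hasContractiveResolvent (hι : DenseRange ι) (hc : 0 < c)
    (ha : ∀ y : V, c * ‖y‖ ^ 2 - β * ‖ι y‖ ^ 2 ≤ a y y) :
    ∃ R : ℝ → H →L[ℝ] H,
      HasContractiveResolvent (fun x h => FormOperatorGraph ι a x (h - β • x)) R := by
  choose! R hR using fun (l : ℝ) (hl : 0 < l) => exists_resolvent_of_semicoercive hc ha hl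
  have hG {l : ℝ} (hl : 0 < l) (y : H) :
      FormOperatorGraph ι a (R l y) (y - l • R l y - β • R l y) := by
    obtain ⟨v, hv, hw⟩ := hR l hl y
    refine ⟨v, hv.symm, fun w => ?_⟩
    rw [inner_sub_left, inner_sub_left, inner_smul_left, inner_smul_left, ← hw w, hv]
    simp; ring
  refine ⟨R, ⟨fun l hl x => ?_, fun l hl x h => ⟨?_, fun hx => ?_⟩, ?_⟩⟩
  · obtain ⟨v, hv, hw⟩ := hR l hl x
    have h1 := hw v
    rw [hv]
    rw [real_inner_self_eq_norm_sq] at h1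
    have h2 := real_inner_le_norm x (ι v)
    have h3 : l * ‖ι v‖ ^ 2 ≤ ‖x‖ * ‖ι v‖ := by nlinarith [ha v, mul_nonneg hc.le (sq_nonneg ‖v‖)]
    rw [inv_mul_eq_div, le_div_iff₀' hl]
    rcases (norm_nonneg (ι v)).eq_or_lt with h0 | h0
    · rw [← h0]; simp
    · exact le_of_mul_le_mul_right (by linarith [sq ‖ι v‖]) h0
  · rintro ⟨v, hv, hw⟩
    obtain ⟨v', hv', hw'⟩ := hR l hl (l • x + h)
    have h1 : a (v - v') (v - v') + (β + l) * ‖ι (v - v')‖ ^ 2 = 0 := by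
      have e1 := hw (v - v')
      have e2 := hw' (v - v')
      rw [← hv] at e1 e2
      have e3 : inner ℝ (ι (v - v')) (ι (v - v')) =
          inner ℝ (ι v) (ι (v - v')) - inner ℝ (ι v') (ι (v - v')) := by
        rw [← inner_sub_left, ← map_sub]
      rw [← real_inner_self_eq_norm_sq, map_sub a, sub_apply, e1, e3, inner_sub_left]
      simp only [inner_add_left, inner_smul_left, RCLike.conj_to_real] at e2 ⊢
      linarith
    have h2 : c * ‖v - v'‖ ^ 2 ≤ 0 := by
      nlinarith [ha (v - v'), mul_nonneg hl.le (sq_nonneg ‖ι (v - v')‖)]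
    have h3 : ‖v - v'‖ ^ 2 = 0 := by
      apply le_antisymm _ (sq_nonneg _)
      by_contra hcon
      push Not at hcon
      nlinarith [mul_pos hc hcon]
    have h4 : v = v' := sub_eq_zero.1 (norm_eq_zero.1 (by simpa using h3))
    rw [hv', ← h4, hv]
  · have h1 := hG hl (l • x + h)
    rw [hx] at h1
    simpa using h1
  -- If `y` is orthogonal to the range, then `⟨R 1 y, y⟩ = 0`, so coercivity forces the weak
  -- solution `v` to vanish. The equation then says `y` is orthogonal to the dense range of `ι`.
  · have h1 : Dense (LinearMap.range (R 1 : H →ₗ[ℝ] H) : Set H) := by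
      rw [Submodule.dense_iff_topologicalClosure_eq_top,
        Submodule.topologicalClosure_eq_top_iff, Submodule.eq_bot_iff]
      intro y hy
      rw [Submodule.mem_orthogonal] at hy
      obtain ⟨v, hv, hw⟩ := hR 1 one_pos y
      have h2 : inner ℝ (R 1 y) y = 0 := hy _ ⟨y, rfl⟩
      have h3 := hw v
      rw [← hv, real_inner_comm (R 1 y) y, h2, hv, real_inner_self_eq_norm_sq] at h3
      have h4 : c * ‖v‖ ^ 2 ≤ 0 := by nlinarith [ha v, sq_nonneg ‖ι v‖]
      have h5 : ‖v‖ ^ 2 = 0 := by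
        apply le_antisymm _ (sq_nonneg _)
        by_contra hcon
        push Not at hcon
        nlinarith [mul_pos hc hcon]
      have h6 : v = 0 := norm_eq_zero.1 (by simpa using h5)
      refine hι.eq_zero_of_inner_left ℝ fun w => ?_
      have h7 := hw w
      rw [h6] at h7
      simpa using h7.symm
    refine h1.mono ?_
    rintro _ ⟨y, rfl⟩
    exact ⟨y - (1 : ℝ) • R 1 y, hG one_pos y⟩

lemma dense_formOperator_domain (hι : DenseRange ι) (ha : IsSemicoercive ι a) :
    Dense {x | ∃ h, FormOperatorGraph ι a x h} := by
  obtain ⟨c, hc, β, ha⟩ := ha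
  obtain ⟨R, hR⟩ := exists_hasContractiveResolvent hι hc ha
  refine hR.dense.mono ?_
  rintro x ⟨h, hx⟩
  exact ⟨_, hx⟩

theorem exists_c0Semigroup_of_semicoercive (hι : DenseRange ι) (ha : IsSemicoercive ι a) :
    ∃ S : C0Semigroup H, S.IsGeneratedByNeg (FormOperatorGraph ι a) := by
  obtain ⟨c, hc, β, ha⟩ := ha
  obtain ⟨R, hR⟩ := exists_hasContractiveResolvent hι hc ha
  obtain ⟨S, hS⟩ := hR.exists_c0Semigroup
  exact ⟨S.rescale β, by simpa using hS.rescale β⟩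

end Form

/-! ### Bounds and compactness of the semigroup of a form -/

section Clip

variable {H : Type*} [NormedAddCommGroup H] [InnerProductSpace ℝ H]

/-- The operator `S(r)` with the time `r` moved to the nearest point of `[0, T]`. -/
noncomputable def C0Semigroup.clip (S : C0Semigroup H) (T r : ℝ) : H →L[ℝ] H :=
  S.toFun (max 0 (min r T))

namespace C0Semigroup

variable (S : C0Semigroup H)

lemma clip_of_mem {T r : ℝ} (hr : r ∈ Icc 0 T) : S.clip T r = S.toFun r := by
  rw [clip, min_eq_left hr.2, max_eq_right hr.1]

lemma continuous_clip_apply (T : ℝ) (x : H) : Continuous fun r => S.clip T r x :=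
  (S.continuousOn x).comp_continuous (by fun_prop) fun r => mem_Ici.2 (le_max_left _ _)

variable [CompleteSpace H]

lemma exists_bound_clip (T : ℝ) : ∃ M : ℝ, 0 ≤ M ∧ ∀ r x, ‖S.clip T r x‖ ≤ M * ‖x‖ := by
  have h : ∀ x, ∃ C, ∀ r : ℝ, ‖S.clip T r x‖ ≤ C := by
    intro x
    obtain ⟨C, hC⟩ := isCompact_Icc.exists_bound_of_continuousOn
      ((S.continuousOn x).mono (Icc_subset_Ici_self : Icc 0 (max 0 T) ⊆ Ici 0))
    exact ⟨C, fun r => hC _ ⟨le_max_left _ _, max_le_max le_rfl (min_le_right _ _)⟩⟩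
  obtain ⟨M, hM⟩ := banach_steinhaus h
  exact ⟨M, (norm_nonneg _).trans (hM 0), fun r x =>
    ((S.clip T r).le_opNorm x).trans (mul_le_mul_of_nonneg_right (hM r) (norm_nonneg x))⟩

lemma continuous_clip_uncurry (T : ℝ) : Continuous fun p : ℝ × H => S.clip T p.1 p.2 := by
  obtain ⟨M, hM0, hM⟩ := S.exists_bound_clip T
  have h := continuous_prod_of_continuous_lipschitzWith (fun p : H × ℝ => S.clip T p.2 p.1) ⟨M, hM0⟩
    (fun x => S.continuous_clip_apply T x)
    (fun r => LipschitzWith.of_dist_le_mul fun x y => by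
      rw [dist_eq_norm, dist_eq_norm, ← map_sub]; exact hM r _)
  exact h.comp continuous_swap

end C0Semigroup

end Clip

/-! ### Energy identity and compactness of `S(t)` for positive times. -/

section Energy

variable {H V : Type*} [NormedAddCommGroup H] [InnerProductSpace ℝ H]
  [NormedAddCommGroup V] [InnerProductSpace ℝ V]
  {ι : V →L[ℝ] H} {a : V →L[ℝ] V →L[ℝ] ℝ} {c β : ℝ} {S : C0Semigroup H}

lemma C0Semigroup.IsGeneratedByNeg.graph_apply {G : H → H → Prop} (hS : S.IsGeneratedByNeg G)
    {x h : H} (hx : G x h) {t : ℝ} (ht : 0 ≤ t) : G (S.toFun t x) (S.toFun t h) := by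
  rw [hS] at hx ⊢
  rw [← map_neg]
  refine (((S.toFun t).continuous.tendsto _).comp hx).congr' ?_
  filter_upwards [self_mem_nhdsWithin] with r hr
  have hr' : 0 ≤ r := le_of_lt hr
  rw [← ContinuousLinearMap.comp_apply (S.toFun r), ← S.map_add r t hr' ht, add_comm,
    S.map_add t r ht hr']
  simp

lemma C0Semigroup.IsGeneratedByNeg.hasDerivWithinAt {G : H → H → Prop} (hS : S.IsGeneratedByNeg G)
    {x h : H} (hx : G x h) {t : ℝ} (ht : 0 ≤ t) :
    HasDerivWithinAt (fun s => S.toFun s x) (-S.toFun t h) (Ioi t) t := by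
  rw [hasDerivWithinAt_iff_tendsto_slope' (by simp)]
  have h1 := (hS _ _).1 (hS.graph_apply hx ht)
  have h2 : Tendsto (fun r : ℝ => r - t) (𝓝[>] t) (𝓝[>] 0) := by
    refine tendsto_nhdsWithin_iff.2 ⟨?_, ?_⟩
    · have : Tendsto (fun r : ℝ => r - t) (𝓝 t) (𝓝 (t - t)) :=
        (continuous_id.sub continuous_const).tendsto t
      rw [sub_self] at this
      exact this.mono_left nhdsWithin_le_nhds
    · filter_upwards [self_mem_nhdsWithin] with r hr
      exact sub_pos.2 (mem_Ioi.1 hr)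
  refine (h1.comp h2).congr' ?_
  filter_upwards [self_mem_nhdsWithin] with r hr
  have hr' : 0 ≤ r - t := sub_nonneg.2 (le_of_lt hr)
  simp only [Function.comp_apply, slope, vsub_eq_sub]
  rw [← ContinuousLinearMap.comp_apply (S.toFun (r - t)), ← S.map_add _ _ hr' ht, sub_add_cancel]

/-- Integrates the right derivative `-2 ⟨S(s) h, S(s) x⟩` of `‖S(s) x‖²`; a right derivative
suffices because the function is continuous. -/
lemma integral_inner_semigroup {G : H → H → Prop} (hS : S.IsGeneratedByNeg G)
    {x h : H} (hx : G x h) {t : ℝ} (ht : 0 ≤ t) :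
    2 * ∫ s in (0 : ℝ)..t, inner ℝ (S.clip t s h) (S.clip t s x) = ‖x‖ ^ 2 - ‖S.toFun t x‖ ^ 2 := by
  have hc : Continuous fun s => -(2 * inner ℝ (S.clip t s h) (S.clip t s x)) :=
    (continuous_const.mul ((S.continuous_clip_apply t h).inner (S.continuous_clip_apply t x))).neg
  have h1 := intervalIntegral.integral_eq_sub_of_hasDeriv_right_of_le ht
    (f := fun s => ‖S.toFun s x‖ ^ 2)
    (f' := fun s => -(2 * inner ℝ (S.clip t s h) (S.clip t s x)))
    (((S.continuousOn x).mono Icc_subset_Ici_self).norm.pow 2)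
    (fun s hs => by
      have h2 := (hS.hasDerivWithinAt hx hs.1.le).norm_sq
      rw [S.clip_of_mem (Ioo_subset_Icc_self hs)]
      rwa [inner_neg_right, real_inner_comm, mul_neg] at h2)
    (hc.intervalIntegrable _ _)
  rw [intervalIntegral.integral_neg, intervalIntegral.integral_const_mul] at h1
  simp only [S.map_zero, ContinuousLinearMap.id_apply] at h1
  linarith

/-- The energy density `⟨S(s) h, S(s) x⟩ + β ‖S(s) x‖²` at time `s` of the solution with initial
value `x`, where `h = A x`. -/
noncomputable def energyDensity (S : C0Semigroup H) (β t : ℝ) (x h : H) (s : ℝ) : ℝ :=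
  inner ℝ (S.clip t s h) (S.clip t s x) + β * ‖S.clip t s x‖ ^ 2

lemma continuous_energyDensity (t : ℝ) (x h : H) : Continuous (energyDensity S β t x h) :=
  ((S.continuous_clip_apply t h).inner (S.continuous_clip_apply t x)).add
    (continuous_const.mul ((S.continuous_clip_apply t x).norm.pow 2))

/-- Semicoercivity at the point of `V` representing `S(s) x`, which stays in the domain. The energy
density thus controls the `V`-norm. -/
lemma exists_le_energyDensity (ha : ∀ y : V, c * ‖y‖ ^ 2 - β * ‖ι y‖ ^ 2 ≤ a y y)
    (hS : S.IsGeneratedByNeg (FormOperatorGraph ι a)) {x h : H} (hx : FormOperatorGraph ι a x h)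
    {s t : ℝ} (hs : s ∈ Icc 0 t) :
    ∃ v, ι v = S.toFun s x ∧ c * ‖v‖ ^ 2 ≤ energyDensity S β t x h s := by
  obtain ⟨v, hv, hw⟩ := hS.graph_apply hx hs.1
  refine ⟨v, hv, ?_⟩
  rw [energyDensity, S.clip_of_mem hs, ← hv, ← hw v]
  linarith [ha v]

lemma integral_energyDensity_le {G : H → H → Prop} (hS : S.IsGeneratedByNeg G)
    {M t : ℝ} (hM : ∀ r x, ‖S.clip t r x‖ ≤ M * ‖x‖) (ht : 0 ≤ t) {x h : H} (hx : G x h) :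
    ∫ s in (0 : ℝ)..t, energyDensity S β t x h s ≤ (1 + t * |β| * M ^ 2) * ‖x‖ ^ 2 := by
  have h1 := integral_inner_semigroup hS hx ht
  have hc1 := (S.continuous_clip_apply t h).inner (𝕜 := ℝ) (S.continuous_clip_apply t x)
  have hc2 : Continuous fun s => β * ‖S.clip t s x‖ ^ 2 :=
    continuous_const.mul ((S.continuous_clip_apply t x).norm.pow 2)
  have h2 : ∫ s in (0 : ℝ)..t, energyDensity S β t x h s =
      (∫ s in (0 : ℝ)..t, inner ℝ (S.clip t s h) (S.clip t s x)) +
      ∫ s in (0 : ℝ)..t, β * ‖S.clip t s x‖ ^ 2 :=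
    intervalIntegral.integral_add (hc1.intervalIntegrable _ _) (hc2.intervalIntegrable _ _)
  have h3 : ∫ s in (0 : ℝ)..t, β * ‖S.clip t s x‖ ^ 2 ≤
      ∫ _ in (0 : ℝ)..t, |β| * (M * ‖x‖) ^ 2 := by
    refine intervalIntegral.integral_mono_on ht (hc2.intervalIntegrable _ _)
      (continuous_const.intervalIntegrable _ _) fun s _ => ?_
    gcongr
    · exact le_abs_self β
    · exact hM s x
  rw [intervalIntegral.integral_const, smul_eq_mul] at h3
  nlinarith [sq_nonneg ‖S.toFun t x‖, sq_nonneg ‖x‖]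

variable [CompleteSpace H] [CompleteSpace V]

omit [CompleteSpace V] in
lemma exists_subseq_tendsto_semigroup (hι : IsCompactOperator ι) (hc : 0 < c)
    (ha : ∀ y : V, c * ‖y‖ ^ 2 - β * ‖ι y‖ ^ 2 ≤ a y y)
    (hS : S.IsGeneratedByNeg (FormOperatorGraph ι a)) {t N : ℝ} (ht : 0 < t)
    {x h : ℕ → H} (hx : ∀ n, FormOperatorGraph ι a (x n) (h n)) (hN : ∀ n, ‖x n‖ ≤ N) :
    ∃ (y : H) (φ : ℕ → ℕ), StrictMono φ ∧ Tendsto (fun n => S.toFun t (x (φ n))) atTop (𝓝 y) := by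
  obtain ⟨M, hM0, hM⟩ := S.exists_bound_clip t
  have hmeas (n : ℕ) : Measurable fun s => ENNReal.ofReal (energyDensity S β t (x n) (h n) s) :=
    (continuous_energyDensity t (x n) (h n)).measurable.ennreal_ofReal
  have hint (n : ℕ) : ∫⁻ s in Ioc 0 t, ENNReal.ofReal (energyDensity S β t (x n) (h n) s) ≤
      ENNReal.ofReal ((1 + t * |β| * M ^ 2) * N ^ 2) := by
    rw [← ofReal_integral_eq_lintegral_ofReal]
    · rw [← intervalIntegral.integral_of_le ht.le]
      refine ENNReal.ofReal_le_ofReal ((integral_energyDensity_le hS hM ht.le (hx n)).trans ?_)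
      gcongr
      exact hN n
    · exact ((continuous_energyDensity t (x n) (h n)).continuousOn.integrableOn_Icc).mono_set
        Ioc_subset_Icc_self
    · filter_upwards [ae_restrict_mem measurableSet_Ioc] with s hs
      obtain ⟨v, -, hv⟩ := exists_le_energyDensity ha hS (hx n) (Ioc_subset_Icc_self hs)
      exact (by positivity : (0 : ℝ) ≤ c * ‖v‖ ^ 2).trans hv
  have hfatou : ∫⁻ s in Ioc 0 t,
      liminf (fun n => ENNReal.ofReal (energyDensity S β t (x n) (h n) s)) atTop ≠ ∞ := by
    -- Fatou turns the uniform bound on the integrals into a finite liminf at almost every time. One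
    -- such time `s` is enough.
    refine ((lintegral_liminf_le hmeas).trans ?_).trans_lt
      (ENNReal.ofReal_lt_top (r := (1 + t * |β| * M ^ 2) * N ^ 2)) |>.ne
    exact liminf_le_of_frequently_le' (Frequently.of_forall hint)
  have hae := ae_lt_top (Measurable.liminf hmeas) hfatou
  have : NeBot (ae (volume.restrict (Ioc 0 t))) := by
    rw [ae_neBot, Ne, Measure.restrict_eq_zero]
    simp [ht]
  obtain ⟨s, hs, hst⟩ := (hae.and (ae_restrict_mem measurableSet_Ioc)).exists
  obtain ⟨C, hC1, hC2⟩ := exists_between hs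
  have hfreq := frequently_lt_of_liminf_lt (by isBoundedDefault) hC1
  obtain ⟨φ, hφ, hφC⟩ := extraction_of_frequently_atTop hfreq
  have hv (n : ℕ) : ∃ v ∈ Metric.closedBall (0 : V) √(C.toReal / c),
      ι v = S.toFun s (x (φ n)) := by
    obtain ⟨v, hv1, hv2⟩ := exists_le_energyDensity ha hS (hx (φ n)) (Ioc_subset_Icc_self hst)
    refine ⟨v, ?_, hv1⟩
    rw [mem_closedBall_zero_iff]
    refine Real.le_sqrt_of_sq_le ?_
    rw [le_div_iff₀' hc]
    exact hv2.trans ((ENNReal.ofReal_le_iff_le_toReal hC2.ne).1 (hφC n).le)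
  obtain ⟨y, -, ψ, hψ, hy⟩ := (hι.isCompact_closure_image_closedBall √(C.toReal / c)).tendsto_subseq
    (fun n => subset_closure (let ⟨v, hv1, hv2⟩ := hv n; ⟨v, hv1, hv2⟩ :
      S.toFun s (x (φ n)) ∈ ι '' Metric.closedBall (0 : V) √(C.toReal / c)))
  -- The subsequence converges at time `s`; `S(t - s)` carries the convergence to time `t`.
  refine ⟨S.toFun (t - s) y, φ ∘ ψ, hφ.comp hψ, ?_⟩
  refine (((S.toFun (t - s)).continuous.tendsto y).comp hy).congr fun n => ?_
  simp only [Function.comp_apply]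
  rw [← ContinuousLinearMap.comp_apply (S.toFun (t - s)),
    ← S.map_add _ _ (sub_nonneg.2 hst.2) hst.1.le, sub_add_cancel]

theorem isCompact_closure_image_semigroup (hι : IsDenseCompactEmbedding ι)
    (ha : IsSemicoercive ι a) (hS : S.IsGeneratedByNeg (FormOperatorGraph ι a)) {t : ℝ}
    (ht : 0 < t) (N : ℝ) : IsCompact (closure (S.toFun t '' Metric.ball 0 N)) := by
  have hD := dense_formOperator_domain hι.denseRange ha
  obtain ⟨c, hc, β, ha⟩ := ha
  refine IsSeqCompact.isCompact fun y hy => ?_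
  -- The energy argument requires initial values in the domain, so the ball is first replaced by its
  -- dense subset of domain vectors.
  have hsub : closure (S.toFun t '' Metric.ball 0 N) ⊆
      closure (S.toFun t '' (Metric.ball 0 N ∩ {x | ∃ h, FormOperatorGraph ι a x h})) :=
    closure_minimal ((image_mono (hD.open_subset_closure_inter Metric.isOpen_ball)).trans
      (image_closure_subset_closure_image (S.toFun t).continuous)) isClosed_closure
  have hx (n : ℕ) : ∃ x h, FormOperatorGraph ι a x h ∧ ‖x‖ ≤ N ∧
      ‖S.toFun t x - y n‖ < 1 / ((n : ℝ) + 1) := by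
    obtain ⟨_, ⟨x, ⟨hx, h, hxh⟩, rfl⟩, hd⟩ :=
      Metric.mem_closure_iff.1 (hsub (hy n)) (1 / ((n : ℝ) + 1)) Nat.one_div_pos_of_nat
    refine ⟨x, h, hxh, (mem_ball_zero_iff.1 hx).le, ?_⟩
    rwa [← dist_eq_norm, dist_comm]
  choose x h hxh hxN hxy using hx
  obtain ⟨z, φ, hφ, hz⟩ := exists_subseq_tendsto_semigroup hι.compact hc ha hS ht hxh hxN
  have h0 : Tendsto (fun n => S.toFun t (x n) - y n) atTop (𝓝 0) :=
    squeeze_zero_norm (fun n => (hxy n).le) tendsto_one_div_add_atTop_nhds_zero_nat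
  have h1 : Tendsto (y ∘ φ) atTop (𝓝 z) := by
    have := hz.sub (h0.comp hφ.tendsto_atTop)
    simpa [Function.comp_def] using this
  exact ⟨z, isClosed_closure.mem_of_tendsto h1 (Eventually.of_forall fun n => hy (φ n)), φ, hφ, h1⟩

end Energy

/-! ### The Duhamel operator -/

section Duhamel

variable {H : Type*} [NormedAddCommGroup H] [InnerProductSpace ℝ H] {S : C0Semigroup H} {T : ℝ}
  {g g' : ℝ → H}

lemma intervalIntegrable_of_timeMeasure {E : Type*} [NormedAddCommGroup E] {g : ℝ → E}
    (hg : Integrable g (timeMeasure T)) {a b : ℝ} (ha : a ∈ Icc 0 T) (hb : b ∈ Icc 0 T) :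
    IntervalIntegrable g volume a b := by
  have h : IntegrableOn g (Icc 0 T) := hg
  exact (h.mono_set (uIcc_subset_Icc ha hb)).intervalIntegrable

/-- `∫₀ᵗ S(t - s) g(s) ds`. -/
noncomputable def duhamel (S : C0Semigroup H) (T : ℝ) (g : ℝ → H) (t : ℝ) : H :=
  ∫ s in (0 : ℝ)..t, S.clip T (t - s) (g s)

lemma mildSolution_eq_duhamel (y₀ : H) (g : ℝ → H) {t : ℝ} (ht : t ∈ Icc 0 T) :
    mildSolution S y₀ g t = S.clip T t y₀ + duhamel S T g t := by
  rw [mildSolution, duhamel, S.clip_of_mem ht]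
  congr 1
  refine intervalIntegral.integral_congr fun s hs => ?_
  rw [uIcc_of_le ht.1] at hs
  rw [S.clip_of_mem ⟨sub_nonneg.2 hs.2, (sub_le_self t hs.1).trans ht.2⟩]

lemma duhamel_congr (h : g =ᵐ[timeMeasure T] g') {t : ℝ} (ht : t ∈ Icc 0 T) :
    duhamel S T g t = duhamel S T g' t := by
  refine intervalIntegral.integral_congr_ae ?_
  filter_upwards [(ae_restrict_iff' measurableSet_Icc).1 h] with s hs hs'
  rw [uIoc_of_le ht.1] at hs'
  rw [hs ⟨hs'.1.le, hs'.2.trans ht.2⟩]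

variable [CompleteSpace H]

lemma C0Semigroup.aestronglyMeasurable_clip_apply (S : C0Semigroup H) {μ : Measure ℝ}
    (hg : AEStronglyMeasurable g μ) (t : ℝ) :
    AEStronglyMeasurable (fun s => S.clip T (t - s) (g s)) μ :=
  (S.continuous_clip_uncurry T).comp_aestronglyMeasurable
    ((continuous_const.sub continuous_id).aestronglyMeasurable.prodMk hg)

lemma C0Semigroup.integrable_clip_apply (S : C0Semigroup H) {μ : Measure ℝ}
    (hg : Integrable g μ) (t : ℝ) : Integrable (fun s => S.clip T (t - s) (g s)) μ := by
  obtain ⟨M, hM0, hM⟩ := S.exists_bound_clip T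
  exact (hg.norm.const_mul M).mono' (S.aestronglyMeasurable_clip_apply hg.1 t)
    (Eventually.of_forall fun s => hM _ _)

omit [CompleteSpace H] in
lemma norm_integral_clip_le {M : ℝ} (hM : ∀ r x, ‖S.clip T r x‖ ≤ M * ‖x‖)
    (hg : Integrable g (timeMeasure T)) {a b : ℝ} (ha : a ∈ Icc 0 T) (hb : b ∈ Icc 0 T)
    (hab : a ≤ b) (t : ℝ) :
    ‖∫ s in a..b, S.clip T (t - s) (g s)‖ ≤ M * ∫ s in a..b, ‖g s‖ := by
  rw [← intervalIntegral.integral_const_mul]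
  exact intervalIntegral.norm_integral_le_of_norm_le hab (Eventually.of_forall fun s _ => hM _ _)
    ((intervalIntegrable_of_timeMeasure hg ha hb).norm.const_mul M)

lemma intervalIntegrable_clip_apply (hg : Integrable g (timeMeasure T)) {a b : ℝ}
    (ha : a ∈ Icc 0 T) (hb : b ∈ Icc 0 T) (t : ℝ) :
    IntervalIntegrable (fun s => S.clip T (t - s) (g s)) volume a b :=
  intervalIntegrable_of_timeMeasure (S.integrable_clip_apply hg t) ha hb

lemma duhamel_add (hg : Integrable g (timeMeasure T)) (hg' : Integrable g' (timeMeasure T)) {t : ℝ}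
    (ht : t ∈ Icc 0 T) :
    duhamel S T (fun s => g s + g' s) t = duhamel S T g t + duhamel S T g' t := by
  have h0 : (0 : ℝ) ∈ Icc 0 T := ⟨le_rfl, ht.1.trans ht.2⟩
  simp only [duhamel, map_add]
  exact intervalIntegral.integral_add (intervalIntegrable_clip_apply hg h0 ht t)
    (intervalIntegrable_clip_apply hg' h0 ht t)

lemma duhamel_sub (hg : Integrable g (timeMeasure T)) (hg' : Integrable g' (timeMeasure T)) {t : ℝ}
    (ht : t ∈ Icc 0 T) :
    duhamel S T (fun s => g s - g' s) t = duhamel S T g t - duhamel S T g' t := by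
  have h0 : (0 : ℝ) ∈ Icc 0 T := ⟨le_rfl, ht.1.trans ht.2⟩
  simp only [duhamel, map_sub]
  exact intervalIntegral.integral_sub (intervalIntegrable_clip_apply hg h0 ht t)
    (intervalIntegrable_clip_apply hg' h0 ht t)

omit [CompleteSpace H] in
lemma norm_duhamel_le {M : ℝ} (hM : ∀ r x, ‖S.clip T r x‖ ≤ M * ‖x‖)
    (hg : Integrable g (timeMeasure T)) {t : ℝ} (ht : t ∈ Icc 0 T) :
    ‖duhamel S T g t‖ ≤ M * ∫ s in (0 : ℝ)..t, ‖g s‖ :=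
  norm_integral_clip_le hM hg ⟨le_rfl, ht.1.trans ht.2⟩ ht ht.1 t

/-- The semigroup law propagates the history up to `r`; only forcing on `[r, t]` remains. -/
lemma duhamel_eq_add (hg : Integrable g (timeMeasure T)) {r t : ℝ} (hr : r ∈ Icc 0 T)
    (ht : t ∈ Icc 0 T) (hrt : r ≤ t) :
    duhamel S T g t =
      S.clip T (t - r) (duhamel S T g r) + ∫ s in r..t, S.clip T (t - s) (g s) := by
  have h0 : (0 : ℝ) ∈ Icc 0 T := ⟨le_rfl, ht.1.trans ht.2⟩
  have h1 : S.clip T (t - r) (duhamel S T g r) = ∫ s in (0 : ℝ)..r, S.clip T (t - s) (g s) := by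
    rw [duhamel, ← ContinuousLinearMap.intervalIntegral_comp_comm _
      (intervalIntegrable_clip_apply hg h0 hr r)]
    refine intervalIntegral.integral_congr fun s hs => ?_
    rw [uIcc_of_le hr.1] at hs
    have e1 : t - r ∈ Icc 0 T := ⟨sub_nonneg.2 hrt, (sub_le_self t hr.1).trans ht.2⟩
    have e2 : r - s ∈ Icc 0 T := ⟨sub_nonneg.2 hs.2, (sub_le_self r hs.1).trans hr.2⟩
    have e3 : t - s ∈ Icc 0 T :=
      ⟨sub_nonneg.2 (hs.2.trans hrt), (sub_le_self t hs.1).trans ht.2⟩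
    simp only [S.clip_of_mem e1, S.clip_of_mem e2, S.clip_of_mem e3]
    rw [← ContinuousLinearMap.comp_apply, ← S.map_add _ _ e1.1 e2.1, sub_add_sub_cancel]
  rw [h1, duhamel, intervalIntegral.integral_add_adjacent_intervals
    (intervalIntegrable_clip_apply hg h0 hr t) (intervalIntegrable_clip_apply hg hr ht t)]

lemma continuousOn_duhamel (hg : Integrable g (timeMeasure T)) :
    ContinuousOn (duhamel S T g) (Icc 0 T) := by
  -- Extension by zero gives an integrable function on the whole line. The two-variable primitive is
  -- then continuous by domination, and the Duhamel integral is its restriction to the diagonal.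
  have hg' : Integrable ((Icc 0 T).indicator g) := (integrable_indicator_iff measurableSet_Icc).2 hg
  obtain ⟨M, hM0, hM⟩ := S.exists_bound_clip T
  have hcont : ContinuousOn (duhamel S T ((Icc 0 T).indicator g)) (Icc 0 T) := by
    intro t ht
    have hp : ContinuousAt (fun p : ℝ × ℝ =>
        ∫ s in (0 : ℝ)..p.2, S.clip T (p.1 - s) ((Icc 0 T).indicator g s)) (t, t) :=
      intervalIntegral.continuousAt_parametric_primitive_of_dominated
        (fun s => M * ‖(Icc 0 T).indicator g s‖) (-1) (T + 1)
        (fun r => (S.aestronglyMeasurable_clip_apply hg'.1 r).restrict)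
        (Eventually.of_forall fun r => Eventually.of_forall fun s => hM _ _)
        (hg'.norm.const_mul M).intervalIntegrable
        (Eventually.of_forall fun s => ((S.continuous_clip_apply T _).comp
          (continuous_id.sub continuous_const)).continuousAt)
        ⟨by linarith, by linarith [ht.1, ht.2]⟩ ⟨by linarith [ht.1], by linarith [ht.2]⟩
        Real.volume_singleton
    exact (ContinuousAt.comp (f := fun r : ℝ => (r, r)) hp
      (continuous_id.prodMk continuous_id).continuousAt).continuousWithinAt
  refine hcont.congr fun t ht => duhamel_congr ?_ ht
  filter_upwards [ae_restrict_mem measurableSet_Icc] with s hs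
  rw [indicator_of_mem hs]

/-- The function `t ↦ ∫₀ᵗ S(t - s) g(s) ds` in `C([0, T]; H)`. -/
noncomputable def duhamelMap (S : C0Semigroup H) (hg : Integrable g (timeMeasure T)) :
    C(Icc (0 : ℝ) T, H) where
  toFun t := duhamel S T g t
  continuous_toFun := (continuousOn_duhamel hg).domRestrict

@[simp]
lemma duhamelMap_apply (hg : Integrable g (timeMeasure T)) (t : Icc (0 : ℝ) T) :
    duhamelMap S hg t = duhamel S T g t := rfl

lemma duhamelMap_sub (hg : Integrable g (timeMeasure T)) (hg' : Integrable g' (timeMeasure T)) :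
    duhamelMap S hg - duhamelMap S hg' = duhamelMap S (hg.sub hg') := by
  ext t
  exact (duhamel_sub hg hg' t.2).symm

lemma norm_duhamelMap_le {M : ℝ} (hM0 : 0 ≤ M) (hM : ∀ r x, ‖S.clip T r x‖ ≤ M * ‖x‖)
    (hg : Integrable g (timeMeasure T)) :
    ‖duhamelMap S hg‖ ≤ M * ∫ s, ‖g s‖ ∂(timeMeasure T) := by
  rw [ContinuousMap.norm_le _ (by positivity)]
  intro t
  refine (norm_duhamel_le hM hg t.2).trans ?_
  gcongr
  rw [intervalIntegral.integral_of_le t.2.1]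
  exact setIntegral_mono_set hg.norm (Eventually.of_forall fun s => norm_nonneg _)
    (Eventually.of_forall (Ioc_subset_Icc_self.trans (Icc_subset_Icc le_rfl t.2.2)))

lemma norm_duhamelMap_sub_le {M : ℝ} (hM0 : 0 ≤ M) (hM : ∀ r x, ‖S.clip T r x‖ ≤ M * ‖x‖)
    (hg : Integrable g (timeMeasure T)) (hg' : Integrable g' (timeMeasure T)) :
    ‖duhamelMap S hg - duhamelMap S hg'‖ ≤ M * ∫ s, ‖g s - g' s‖ ∂(timeMeasure T) := by
  rw [duhamelMap_sub]
  exact norm_duhamelMap_le hM0 hM (hg.sub hg')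

end Duhamel

/-! ### Compactness of the Duhamel operator -/

section Compactness

variable {E : Type*} [NormedAddCommGroup E] {T : ℝ}

/-- Pointwise Young inequality `‖g‖ ≤ 1/η + η ‖g‖²`, used in place of Cauchy-Schwarz. -/
lemma intervalIntegral_norm_le {g : ℝ → E} (hg : MemLp g 2 (timeMeasure T))
    {a b η : ℝ} (ha : a ∈ Icc 0 T) (hb : b ∈ Icc 0 T) (hab : a ≤ b) (hη : 0 < η) :
    ∫ s in a..b, ‖g s‖ ≤ (b - a) / η + η * ∫ s, ‖g s‖ ^ 2 ∂(timeMeasure T) := by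
  have hg2 : Integrable (fun s => ‖g s‖ ^ 2) (timeMeasure T) := hg.integrable_norm_pow two_ne_zero
  have hg1 : Integrable g (timeMeasure T) := hg.integrable (by norm_num)
  have h1 := intervalIntegrable_of_timeMeasure hg1 ha hb
  have h2 := intervalIntegrable_of_timeMeasure hg2 ha hb
  calc ∫ s in a..b, ‖g s‖ ≤ ∫ s in a..b, (1 / η + η * ‖g s‖ ^ 2) := by
        refine intervalIntegral.integral_mono_on hab h1.norm
          (intervalIntegrable_const.add (h2.const_mul η)) fun s _ => ?_
        rw [← sub_nonneg]
        have : 1 / η + η * ‖g s‖ ^ 2 - ‖g s‖ = ((η * ‖g s‖ - 1 / 2) ^ 2 + 3 / 4) / η := by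
          field_simp; ring
        rw [this]; positivity
    _ = (b - a) / η + η * ∫ s in a..b, ‖g s‖ ^ 2 := by
        rw [intervalIntegral.integral_add intervalIntegrable_const (h2.const_mul η),
          intervalIntegral.integral_const, intervalIntegral.integral_const_mul, smul_eq_mul,
          mul_one_div]
    _ ≤ _ := by
        gcongr
        rw [intervalIntegral.integral_of_le hab]
        exact setIntegral_mono_set hg2 (Eventually.of_forall fun s => sq_nonneg _)
          (Eventually.of_forall (Ioc_subset_Icc_self.trans (Icc_subset_Icc ha.1 hb.2)))

lemma exists_modulus_intervalIntegral_norm (T : ℝ) {N : ℝ} (hN : 0 ≤ N) {ε : ℝ} (hε : 0 < ε) :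
    ∃ δ > 0, ∀ g : ℝ → E, MemLp g 2 (timeMeasure T) → ∫ s, ‖g s‖ ^ 2 ∂(timeMeasure T) ≤ N →
      ∀ a ∈ Icc 0 T, ∀ b ∈ Icc 0 T, a ≤ b → b - a ≤ δ → ∫ s in a..b, ‖g s‖ < ε := by
  set η := ε / (4 * (N + 1)) with hη
  have hη0 : 0 < η := by positivity
  refine ⟨ε / 4 * η, by positivity, fun g hg hgN a ha b hb hab hδ => ?_⟩
  have h1 := intervalIntegral_norm_le hg ha hb hab hη0
  have h2 : (b - a) / η ≤ ε / 4 := by rwa [div_le_iff₀ hη0]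
  have h3 : η * ∫ s, ‖g s‖ ^ 2 ∂(timeMeasure T) ≤ ε / 4 := by
    calc η * ∫ s, ‖g s‖ ^ 2 ∂(timeMeasure T) ≤ η * (N + 1) := by gcongr; linarith
      _ = ε / 4 := by rw [hη]; field_simp
  linarith

variable {H : Type*} [NormedAddCommGroup H] [InnerProductSpace ℝ H] [CompleteSpace H]
  {S : C0Semigroup H}

/-- The values of the functions `∫₀ᵗ S(t - s) g(s) ds`, for `∫ ‖g‖² ≤ N`. -/
def duhamelValues (S : C0Semigroup H) (T N : ℝ) : Set H :=
  {y | ∃ g : ℝ → H, MemLp g 2 (timeMeasure T) ∧ ∫ s, ‖g s‖ ^ 2 ∂(timeMeasure T) ≤ N ∧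
    ∃ t ∈ Icc 0 T, duhamel S T g t = y}

/-- Up to a uniformly small integral over the last `δ`, each value is `S(δ)` applied to an earlier
one. Earlier values are bounded and `S(δ)` is compact. -/
lemma totallyBounded_duhamelValues
    (hS : ∀ t, 0 < t → ∀ R, IsCompact (closure (S.toFun t '' Metric.ball 0 R)))
    {N : ℝ} (hN : 0 ≤ N) : TotallyBounded (duhamelValues S T N) := by
  obtain ⟨M, hM0, hM⟩ := S.exists_bound_clip T
  rw [Metric.totallyBounded_iff]
  intro ε hε
  obtain ⟨δ, hδ, hmod⟩ := exists_modulus_intervalIntegral_norm (E := H) T hN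
    (show 0 < ε / (2 * (M + 1)) by positivity)
  have hsmall {g : ℝ → H} (hg : MemLp g 2 (timeMeasure T))
      (hgN : ∫ s, ‖g s‖ ^ 2 ∂(timeMeasure T) ≤ N) {a b : ℝ} (ha : a ∈ Icc 0 T) (hb : b ∈ Icc 0 T)
      (hab : a ≤ b) (h : b - a ≤ δ) (t : ℝ) : ‖∫ s in a..b, S.clip T (t - s) (g s)‖ < ε / 2 := by
    refine (norm_integral_clip_le hM (hg.integrable (by norm_num)) ha hb hab t).trans_lt ?_
    have h0 : 0 ≤ ∫ s in a..b, ‖g s‖ :=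
      intervalIntegral.integral_nonneg hab fun s _ => norm_nonneg _
    calc M * ∫ s in a..b, ‖g s‖ ≤ (M + 1) * ∫ s in a..b, ‖g s‖ := by gcongr; linarith
      _ < (M + 1) * (ε / (2 * (M + 1))) := by gcongr; exact hmod g hg hgN a ha b hb hab h
      _ = ε / 2 := by field_simp
  obtain ⟨F, hF, hcover⟩ := Metric.totallyBounded_iff.1
    ((hS δ hδ (M * (T + N) + 1)).totallyBounded.subset subset_closure) (ε / 2) (by positivity)
  -- The centre `0` covers the values at times `t ≤ δ`, which are themselves small.
  refine ⟨insert 0 F, hF.insert 0, ?_⟩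
  rintro _ ⟨g, hg, hgN, t, ht, rfl⟩
  have hg1 : Integrable g (timeMeasure T) := hg.integrable (by norm_num)
  have h0 : (0 : ℝ) ∈ Icc 0 T := ⟨le_rfl, ht.1.trans ht.2⟩
  rw [mem_iUnion₂]
  rcases le_total t δ with htδ | htδ
  · refine ⟨0, mem_insert _ _, ?_⟩
    rw [mem_ball_zero_iff]
    exact (hsmall hg hgN h0 ht ht.1 (by linarith) t).trans (by linarith)
  · have hr : t - δ ∈ Icc 0 T := ⟨sub_nonneg.2 htδ, by linarith [ht.2]⟩
    have h1 := duhamel_eq_add (S := S) hg1 hr ht (by linarith)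
    have h2 : ‖duhamel S T g (t - δ)‖ < M * (T + N) + 1 := by
      refine (norm_duhamel_le hM hg1 hr).trans_lt ?_
      have h3 := intervalIntegral_norm_le hg h0 hr hr.1 one_pos
      have h4 : ∫ s in (0 : ℝ)..(t - δ), ‖g s‖ ≤ T + N := by linarith [hr.2]
      nlinarith [mul_le_mul_of_nonneg_left h4 hM0]
    rw [sub_sub_cancel, S.clip_of_mem ⟨hδ.le, htδ.trans ht.2⟩] at h1
    obtain ⟨y, hy, hyd⟩ := mem_iUnion₂.1 (hcover ⟨_, mem_ball_zero_iff.2 h2, rfl⟩)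
    refine ⟨y, mem_insert_of_mem _ hy, ?_⟩
    rw [Metric.mem_ball, dist_eq_norm] at hyd ⊢
    rw [h1, add_sub_right_comm]
    have h5 := hsmall hg hgN hr ht (by linarith) (by linarith) t
    exact (norm_add_le _ _).trans_lt (by linarith)

/-- Strong continuity at zero is uniform on compact sets, by joint continuity and the tube lemma. -/
lemma C0Semigroup.exists_norm_clip_sub_lt (S : C0Semigroup H) {K : Set H}
    (hK : IsCompact K) (hT : 0 ≤ T) {ε : ℝ} (hε : 0 < ε) : ∃ δ > 0, ∀ r, |r| < δ → ∀ x ∈ K, ‖S.clip T r x - x‖ < ε := by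
  have hopen : IsOpen {p : ℝ × H | ‖S.clip T p.1 p.2 - p.2‖ < ε} :=
    isOpen_lt (((S.continuous_clip_uncurry T).sub continuous_snd).norm) continuous_const
  obtain ⟨u, v, hu, -, h0u, hKv, huv⟩ := generalized_tube_lemma (isCompact_singleton (x := (0 : ℝ)))
    hK hopen (by
      rintro ⟨r, x⟩ ⟨hr, -⟩
      rw [mem_singleton_iff] at hr
      simp only at hr
      subst hr
      simpa [S.clip_of_mem (T := T) ⟨le_rfl, hT⟩, S.map_zero] using hε)
  obtain ⟨δ, hδ, hδu⟩ := Metric.isOpen_iff.1 hu 0 (h0u rfl)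
  exact ⟨δ, hδ, fun r hr x hx => huv
    (mk_mem_prod (hδu (by simpa using hr)) (hKv hx))⟩

/-- Arzelà-Ascoli. Between `r` and `t` the increment is `(S(t - r) - 1)` applied to the value at
`r`, plus a short integral. The first term is uniformly small because the values lie in a compact
set. -/
theorem exists_isCompact_duhamelMap_mem
    (hS : ∀ t, 0 < t → ∀ R, IsCompact (closure (S.toFun t '' Metric.ball 0 R))) (hT : 0 ≤ T)
    {N : ℝ} (hN : 0 ≤ N) :
    ∃ K : Set C(Icc (0 : ℝ) T, H), IsCompact K ∧ ∀ (g : ℝ → H) (hg : Integrable g (timeMeasure T)),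
      MemLp g 2 (timeMeasure T) → ∫ s, ‖g s‖ ^ 2 ∂(timeMeasure T) ≤ N → duhamelMap S hg ∈ K := by
  obtain ⟨M, hM0, hM⟩ := S.exists_bound_clip T
  have hW : IsCompact (closure (duhamelValues S T N)) :=
    (totallyBounded_duhamelValues hS hN).closure.isCompact_of_isClosed isClosed_closure
  let A : Set (BoundedContinuousFunction (Icc (0 : ℝ) T) H) :=
    {f | ∃ (g : ℝ → H) (hg : Integrable g (timeMeasure T)), MemLp g 2 (timeMeasure T) ∧
      ∫ s, ‖g s‖ ^ 2 ∂(timeMeasure T) ≤ N ∧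
      f = BoundedContinuousFunction.mkOfCompact (duhamelMap S hg)}
  have hA : IsCompact (closure A) := by
    refine BoundedContinuousFunction.arzela_ascoli _ hW A ?_ ?_
    · rintro _ t ⟨g, hg, hg2, hgN, rfl⟩
      exact subset_closure ⟨g, hg2, hgN, t, t.2, rfl⟩
    · refine UniformEquicontinuous.equicontinuous ?_
      rw [Metric.uniformEquicontinuous_iff]
      intro ε hε
      obtain ⟨δ₁, hδ₁, h1⟩ := S.exists_norm_clip_sub_lt hW hT (show 0 < ε / 2 by positivity)
      obtain ⟨δ₂, hδ₂, h2⟩ := exists_modulus_intervalIntegral_norm (E := H) T hN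
        (show 0 < ε / (2 * (M + 1)) by positivity)
      have key (g : ℝ → H) (hg : Integrable g (timeMeasure T)) (hg2 : MemLp g 2 (timeMeasure T))
          (hgN : ∫ s, ‖g s‖ ^ 2 ∂(timeMeasure T) ≤ N) (r t : ℝ) (hr : r ∈ Icc 0 T)
          (ht : t ∈ Icc 0 T) (hrt : r ≤ t) (hd : t - r < min δ₁ δ₂) :
          ‖duhamel S T g t - duhamel S T g r‖ < ε := by
        have e1 := h1 (t - r)
          (by rw [abs_of_nonneg (sub_nonneg.2 hrt)]; exact hd.trans_le (min_le_left _ _))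
          (duhamel S T g r) (subset_closure ⟨g, hg2, hgN, r, hr, rfl⟩)
        have e2 := h2 g hg2 hgN r hr t ht hrt (hd.le.trans (min_le_right _ _))
        have e3 := norm_integral_clip_le hM hg hr ht hrt t
        have h0 : 0 ≤ ∫ s in r..t, ‖g s‖ :=
          intervalIntegral.integral_nonneg hrt fun s _ => norm_nonneg _
        have e4 : M * ∫ s in r..t, ‖g s‖ < ε / 2 := by
          calc M * ∫ s in r..t, ‖g s‖ ≤ (M + 1) * ∫ s in r..t, ‖g s‖ := by gcongr; linarith
            _ < (M + 1) * (ε / (2 * (M + 1))) := by gcongr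
            _ = ε / 2 := by field_simp
        rw [duhamel_eq_add hg hr ht hrt, add_sub_right_comm]
        exact (norm_add_le _ _).trans_lt (by linarith)
      refine ⟨min δ₁ δ₂, lt_min hδ₁ hδ₂, ?_⟩
      rintro r t hd ⟨_, g, hg, hg2, hgN, rfl⟩
      change dist (duhamel S T g r) (duhamel S T g t) < ε
      rw [Subtype.dist_eq, Real.dist_eq] at hd
      rcases le_total (r : ℝ) t with hrt | hrt
      · rw [dist_comm, dist_eq_norm]
        rw [abs_sub_comm, abs_of_nonneg (sub_nonneg.2 hrt)] at hd
        exact key g hg hg2 hgN r t r.2 t.2 hrt hd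
      · rw [dist_eq_norm]
        rw [abs_of_nonneg (sub_nonneg.2 hrt)] at hd
        exact key g hg hg2 hgN t r t.2 r.2 hrt hd
  refine ⟨(ContinuousMap.isometryEquivBoundedOfCompact (Icc (0 : ℝ) T) H).symm '' closure A,
    hA.image (IsometryEquiv.continuous _), fun g hg hg2 hgN => ?_⟩
  exact ⟨BoundedContinuousFunction.mkOfCompact (duhamelMap S hg),
    subset_closure ⟨g, hg, hg2, hgN, rfl⟩, rfl⟩

end Compactness

/-! ### The compactness hypothesis -/

section CompactnessHypothesis

variable {H : Type*} [NormedAddCommGroup H] [InnerProductSpace ℝ H] {T : ℝ}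

omit [InnerProductSpace ℝ H] in
lemma memLp_iccExtend (hT : 0 ≤ T) (p : ℝ≥0∞) (Ψ : C(Icc (0 : ℝ) T, H)) :
    MemLp (IccExtend hT Ψ) p (timeMeasure T) :=
  MemLp.of_bound Ψ.continuous.Icc_extend'.aestronglyMeasurable ‖Ψ‖
    (Eventually.of_forall fun _ => Ψ.norm_coe_le_norm _)

/-- A continuous function on `[0, T]` as an element of `L²(0, T; H)`. -/
noncomputable def iccToLp (hT : 0 ≤ T) (Ψ : C(Icc (0 : ℝ) T, H)) : LTime H 2 T :=
  (memLp_iccExtend hT 2 Ψ).toLp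

omit [InnerProductSpace ℝ H] in
lemma continuous_iccToLp (hT : 0 ≤ T) :
    Continuous (iccToLp hT : C(Icc (0 : ℝ) T, H) → LTime H 2 T) := by
  refine (LipschitzWith.of_dist_le_mul
    (K := measureUnivNNReal (timeMeasure T) ^ (2 : ℝ≥0∞).toReal⁻¹) fun Ψ Φ => ?_).continuous
  rw [dist_eq_norm, dist_eq_norm, iccToLp, iccToLp, ← MemLp.toLp_sub]
  refine Lp.norm_le_of_ae_bound (norm_nonneg _) ?_
  filter_upwards [MemLp.coeFn_toLp ((memLp_iccExtend hT 2 Ψ).sub (memLp_iccExtend hT 2 Φ))]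
    with t ht
  rw [ht]
  exact (Ψ - Φ).norm_coe_le_norm (projIcc 0 T hT t)

lemma integral_norm_sq_eq (g : LTime H 2 T) : ∫ s, ‖g s‖ ^ 2 ∂(timeMeasure T) = ‖g‖ ^ 2 := by
  rw [← real_inner_self_eq_norm_sq, L2.inner_def]
  simp only [real_inner_self_eq_norm_sq]

omit [InnerProductSpace ℝ H] in
lemma integrable_of_lp_two (g : LTime H 2 T) : Integrable g (timeMeasure T) :=
  (Lp.memLp g).integrable (by norm_num)

lemma integral_norm_le_mul_norm (hT : 0 ≤ T) (g : LTime H 2 T) :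
    ∫ s, ‖g s‖ ∂(timeMeasure T) ≤ (T + 1) * ‖g‖ := by
  rcases eq_or_ne g 0 with rfl | hg
  · rw [norm_zero, mul_zero]
    refine (integral_eq_zero_of_ae ?_).le
    filter_upwards [Lp.coeFn_zero H 2 (timeMeasure T)] with s hs
    rw [hs]; simp
  · have hg0 : 0 < ‖g‖ := norm_pos_iff.2 hg
    -- The choice `η = 1 / ‖g‖` makes the bound homogeneous in `g`.
    have h := intervalIntegral_norm_le (Lp.memLp g) ⟨le_rfl, hT⟩ ⟨hT, le_rfl⟩ hT (inv_pos.2 hg0)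
    rw [integral_norm_sq_eq, intervalIntegral.integral_of_le hT, ← integral_Icc_eq_integral_Ioc] at h
    refine h.trans_eq ?_
    field_simp
    ring

variable [CompleteSpace H] {S : C0Semigroup H}

lemma continuous_duhamelMap (S : C0Semigroup H) (hT : 0 ≤ T) :
    Continuous fun g : LTime H 2 T => duhamelMap S (integrable_of_lp_two g) := by
  obtain ⟨M, hM0, hM⟩ := S.exists_bound_clip T
  refine (LipschitzWith.of_dist_le_mul (K := ⟨M * (T + 1), by positivity⟩) fun g g' => ?_).continuous
  rw [dist_eq_norm, dist_eq_norm]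
  refine (norm_duhamelMap_sub_le hM0 hM _ _).trans ?_
  change _ ≤ M * (T + 1) * ‖g - g'‖
  rw [mul_assoc]
  gcongr
  refine le_trans (le_of_eq ?_) (integral_norm_le_mul_norm hT (g - g'))
  refine integral_congr_ae ?_
  filter_upwards [Lp.coeFn_sub g g'] with s hs
  rw [hs, Pi.sub_apply]

/-- The trajectory `t ↦ S(t) y₀` in `C([0, T]; H)`. -/
noncomputable def freeMap (S : C0Semigroup H) (T : ℝ) (y₀ : H) : C(Icc (0 : ℝ) T, H) where
  toFun t := S.clip T t y₀
  continuous_toFun := (S.continuous_clip_apply T y₀).comp continuous_subtype_val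

theorem compactnessHypothesis_of_isCompact
    (hS : ∀ t, 0 < t → ∀ R, IsCompact (closure (S.toFun t '' Metric.ball 0 R))) (hT : 0 ≤ T)
    (B : H →L[ℝ] H) : CompactnessHypothesis S B T := by
  intro y₀
  let P : C(Icc (0 : ℝ) T, H) → LTime H 2 T :=
    fun Ψ => iccToLp hT ((B : C(H, H)).comp (freeMap S T y₀ + Ψ))
  have hP : Continuous P := (continuous_iccToLp hT).comp
    ((ContinuousMap.continuous_postcomp _).comp (continuous_const.add continuous_id))
  refine ⟨fun g => P (duhamelMap S (integrable_of_lp_two g)), fun g => ?_,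
    hP.comp (continuous_duhamelMap S hT), fun K hK => ?_⟩
  · filter_upwards [MemLp.coeFn_toLp (memLp_iccExtend hT 2
      ((B : C(H, H)).comp (freeMap S T y₀ + duhamelMap S (integrable_of_lp_two g)))),
      ae_restrict_mem measurableSet_Icc] with t ht hmem
    refine ht.trans ?_
    rw [IccExtend_of_mem _ _ hmem, mildSolution_eq_duhamel y₀ g hmem]
    rfl
  · obtain ⟨R, hR⟩ := hK.exists_norm_le
    obtain ⟨C, hC, hmem⟩ := exists_isCompact_duhamelMap_mem hS hT (sq_nonneg R)
    refine (hC.image hP).closure_of_subset ?_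
    rintro _ ⟨g, hg, rfl⟩
    refine ⟨_, hmem g (integrable_of_lp_two g) (Lp.memLp g) ?_, rfl⟩
    rw [integral_norm_sq_eq]
    gcongr
    exact hR g hg

end CompactnessHypothesis

/-! ### Volterra equations with integrable kernels -/

section Volterra

variable {T : ℝ}

lemma integral_exp_kernel_le {k t : ℝ} (hk : 0 < k) :
    ∫ s in (0 : ℝ)..t, Real.exp (-(k * (t - s))) ≤ 1 / k := by
  have hd (s : ℝ) : HasDerivAt (fun s => Real.exp (-(k * (t - s))) / k)
      (Real.exp (-(k * (t - s)))) s := by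
    have h : HasDerivAt (fun s => -(k * (t - s))) k s := by
      have e : (fun s => -(k * (t - s))) = fun s => k * (s - t) := by ext; ring
      rw [e]
      simpa using ((hasDerivAt_id s).sub_const t).const_mul k
    simpa [hk.ne'] using h.exp.div_const k
  rw [intervalIntegral.integral_eq_sub_of_hasDerivAt (fun s _ => hd s)
    (Continuous.intervalIntegrable (by fun_prop) _ _)]
  simp only [sub_self, mul_zero, neg_zero, Real.exp_zero]
  linarith [show 0 ≤ Real.exp (-(k * (t - 0))) / k by positivity]

/-- The bounded part of `u` gains the factor `1 / k` from the kernel; the remainder `r` is only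
integrated. Truncating an `L¹` control makes `r` small, and for feasible controls `r = 0`. -/
lemma integral_abs_mul_exp_kernel_le {u r : ℝ → ℝ} (hu : Integrable u (timeMeasure T))
    (hr : Integrable r (timeMeasure T)) (hr0 : ∀ s, 0 ≤ r s) {N k t : ℝ} (hN : 0 ≤ N) (hk : 0 < k)
    (hur : ∀ᵐ s ∂(timeMeasure T), |u s| ≤ N + r s) (ht : t ∈ Icc 0 T) :
    ∫ s in (0 : ℝ)..t, |u s| * Real.exp (-(k * (t - s))) ≤
      N / k + ∫ s, r s ∂(timeMeasure T) := by
  have h0 : (0 : ℝ) ∈ Icc 0 T := ⟨le_rfl, ht.1.trans ht.2⟩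
  have hc : Continuous fun s => Real.exp (-(k * (t - s))) := by fun_prop
  have h1 := intervalIntegrable_of_timeMeasure hr h0 ht
  have h2 : ∫ s in (0 : ℝ)..t, |u s| * Real.exp (-(k * (t - s))) ≤
      ∫ s in (0 : ℝ)..t, (N * Real.exp (-(k * (t - s))) + r s) := by
    refine intervalIntegral.integral_mono_ae_restrict ht.1
      ((intervalIntegrable_of_timeMeasure hu h0 ht).abs.mul_continuousOn hc.continuousOn)
      ((hc.intervalIntegrable _ _).const_mul N |>.add h1) ?_
    filter_upwards [ae_restrict_of_ae_restrict_of_subset (Icc_subset_Icc le_rfl ht.2) hur,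
      ae_restrict_mem measurableSet_Icc] with s hs hst
    have h3 : Real.exp (-(k * (t - s))) ≤ 1 :=
      Real.exp_le_one_iff.2 (neg_nonpos.2 (mul_nonneg hk.le (sub_nonneg.2 hst.2)))
    calc |u s| * Real.exp (-(k * (t - s))) ≤ (N + r s) * Real.exp (-(k * (t - s))) := by gcongr
      _ ≤ N * Real.exp (-(k * (t - s))) + r s := by
        rw [add_mul]; gcongr; exact mul_le_of_le_one_right (hr0 s) h3
  refine h2.trans ?_
  rw [intervalIntegral.integral_add ((hc.intervalIntegrable _ _).const_mul N) h1,
    intervalIntegral.integral_const_mul]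
  have h4 : ∫ s in (0 : ℝ)..t, r s ≤ ∫ s, r s ∂(timeMeasure T) := by
    rw [intervalIntegral.integral_of_le ht.1]
    exact setIntegral_mono_set hr (Eventually.of_forall hr0)
      (Eventually.of_forall (Ioc_subset_Icc_self.trans (Icc_subset_Icc le_rfl ht.2)))
  have h5 := mul_le_mul_of_nonneg_left (integral_exp_kernel_le (t := t) hk) hN
  rw [mul_one_div] at h5
  linarith

lemma exists_integral_abs_mul_exp_kernel_le {u : ℝ → ℝ} (hu : Integrable u (timeMeasure T))
    {ε : ℝ} (hε : 0 < ε) : ∃ k : ℝ, 0 < k ∧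
      ∀ t ∈ Icc 0 T, ∫ s in (0 : ℝ)..t, |u s| * Real.exp (-(k * (t - s))) ≤ ε := by
  have hint (n : ℕ) : Integrable (fun s => max (|u s| - n) 0) (timeMeasure T) :=
    (hu.abs.sub (integrable_const _)).sup (integrable_zero _ _ _)
  have hlim : Tendsto (fun n : ℕ => ∫ s, max (|u s| - n) 0 ∂(timeMeasure T)) atTop (𝓝 0) := by
    suffices h : Tendsto (fun n : ℕ => ∫ s, max (|u s| - n) 0 ∂(timeMeasure T)) atTop
        (𝓝 (∫ _, (0 : ℝ) ∂(timeMeasure T))) by rwa [integral_zero] at h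
    refine tendsto_integral_of_dominated_convergence (fun s => |u s|) (fun n => (hint n).1) hu.abs
      (fun n => Eventually.of_forall fun s => ?_) (Eventually.of_forall fun s => ?_)
    · rw [Real.norm_of_nonneg (le_max_right _ _)]
      exact max_le (sub_le_self _ n.cast_nonneg) (abs_nonneg _)
    · refine tendsto_const_nhds.congr' ?_
      filter_upwards [eventually_ge_atTop ⌈|u s|⌉₊] with n hn
      rw [max_eq_right (sub_nonpos.2 ((Nat.le_ceil _).trans (Nat.cast_le.2 hn)))]
  obtain ⟨n, hn⟩ := (hlim.eventually_lt_const (show 0 < ε / 2 by positivity)).exists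
  -- This makes `n / k ≤ ε / 2`; `n + 1` keeps `k` positive when `n = 0`.
  refine ⟨2 * (n + 1) / ε, by positivity, fun t ht => ?_⟩
  refine (integral_abs_mul_exp_kernel_le hu (hint n) (fun s => le_max_right _ _) n.cast_nonneg
    (by positivity) (Eventually.of_forall fun s => ?_) ht).trans ?_
  · linarith [le_max_left (|u s| - n) 0]
  · have : (n : ℝ) / (2 * (n + 1) / ε) ≤ ε / 2 := by
      rw [div_le_iff₀ (by positivity)]
      field_simp
      linarith
    linarith

variable {H : Type*} [NormedAddCommGroup H] [NormedSpace ℝ H]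

/-- Multiplication by `e^{k t}` on `C([0, T]; H)`. -/
noncomputable def expWeight (k : ℝ) (Ψ : C(Icc (0 : ℝ) T, H)) : C(Icc (0 : ℝ) T, H) where
  toFun t := Real.exp (k * t) • Ψ t

@[simp]
lemma expWeight_apply (k : ℝ) (Ψ : C(Icc (0 : ℝ) T, H)) (t : Icc (0 : ℝ) T) :
    expWeight k Ψ t = Real.exp (k * t) • Ψ t := rfl

lemma expWeight_neg_expWeight (k : ℝ) (Ψ : C(Icc (0 : ℝ) T, H)) :
    expWeight (-k) (expWeight k Ψ) = Ψ := by
  ext t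
  rw [expWeight_apply, expWeight_apply, smul_smul, ← Real.exp_add, neg_mul, neg_add_cancel,
    Real.exp_zero, one_smul]

/-- Bielecki's device: conjugating `F` with the weight turns the weighted estimate into a
contraction for the usual sup norm. -/
lemma existsUnique_fixedPoint_of_expWeight [CompleteSpace H]
    (F : C(Icc (0 : ℝ) T, H) → C(Icc (0 : ℝ) T, H)) (k : ℝ)
    (hF : ∀ Ψ Φ, ‖expWeight (-k) (F Ψ - F Φ)‖ ≤ 1 / 2 * ‖expWeight (-k) (Ψ - Φ)‖) :
    ∃! Ψ, F Ψ = Ψ := by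
  have hsub (Ψ Φ : C(Icc (0 : ℝ) T, H)) (l : ℝ) :
      expWeight l (Ψ - Φ) = expWeight l Ψ - expWeight l Φ := by
    ext t; simp [smul_sub]
  have hcontr : ContractingWith (1 / 2)
      (fun Ψ => expWeight (-k) (F (expWeight k Ψ))) := by
    refine ⟨by rw [← NNReal.coe_lt_coe]; norm_num, LipschitzWith.of_dist_le_mul fun Ψ Φ => ?_⟩
    rw [dist_eq_norm, dist_eq_norm, ← hsub]
    refine (hF _ _).trans_eq ?_
    rw [← hsub, expWeight_neg_expWeight]
    simp
  have hfix := hcontr.fixedPoint_isFixedPt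
  have hneg (Ψ : C(Icc (0 : ℝ) T, H)) : expWeight k (expWeight (-k) Ψ) = Ψ := by
    simpa using expWeight_neg_expWeight (-k) Ψ
  refine ⟨expWeight k (hcontr.fixedPoint _), ?_, fun Ψ hΨ => ?_⟩
  · change F _ = _
    rw [← hneg (F _)]
    congr 1
  · rw [← hneg Ψ]
    congr 1
    refine hcontr.fixedPoint_unique ?_
    change expWeight (-k) (F (expWeight k (expWeight (-k) Ψ))) = _
    rw [hneg, hΨ]

lemma norm_expWeight_neg_le {k : ℝ} (hk : 0 ≤ k) (Ψ : C(Icc (0 : ℝ) T, H)) :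
    ‖expWeight (-k) Ψ‖ ≤ ‖Ψ‖ := by
  rw [ContinuousMap.norm_le _ (norm_nonneg _)]
  intro t
  rw [expWeight_apply, norm_smul, Real.norm_of_nonneg (Real.exp_pos _).le]
  refine (mul_le_of_le_one_left (norm_nonneg _) (Real.exp_le_one_iff.2 ?_)).trans
    (Ψ.norm_coe_le_norm t)
  nlinarith [mul_nonneg hk t.2.1]

lemma norm_le_exp_mul_norm_expWeight_neg {k : ℝ} (hk : 0 ≤ k) (Ψ : C(Icc (0 : ℝ) T, H)) :
    ‖Ψ‖ ≤ Real.exp (k * T) * ‖expWeight (-k) Ψ‖ := by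
  rw [ContinuousMap.norm_le _ (by positivity)]
  intro t
  have h : Ψ t = Real.exp (k * t) • expWeight (-k) Ψ t := by
    rw [expWeight_apply, smul_smul, ← Real.exp_add, neg_mul, add_neg_cancel, Real.exp_zero,
      one_smul]
  rw [h, norm_smul, Real.norm_of_nonneg (Real.exp_pos _).le]
  gcongr
  · exact t.2.2
  · exact ContinuousMap.norm_coe_le_norm _ _

end Volterra

/-! ### The state equation -/

section State

variable {T : ℝ}

lemma integral_timeMeasure_le (hT : 0 ≤ T) {r : ℝ → ℝ} (hr : Integrable r (timeMeasure T)) {C : ℝ}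
    (h : ∀ᵐ s ∂(timeMeasure T), r s ≤ C) : ∫ s, r s ∂(timeMeasure T) ≤ T * C := by
  refine (integral_mono_ae hr (integrable_const C) h).trans_eq ?_
  simp [hT]

variable {H : Type*} [NormedAddCommGroup H] [InnerProductSpace ℝ H]

namespace ProblemData

variable (D : ProblemData H T) (hT : 0 < T)

/-- The factor `B₁ + B₂ Ψ(s)` of the control. -/
noncomputable def gain (Ψ : C(Icc (0 : ℝ) T, H)) (s : ℝ) : H :=
  D.B₁ + D.B₂ (IccExtend hT.le Ψ s)

lemma continuous_gain (Ψ : C(Icc (0 : ℝ) T, H)) : Continuous (D.gain hT Ψ) :=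
  continuous_const.add (D.B₂.continuous.comp Ψ.continuous.Icc_extend')

lemma norm_gain_le (Ψ : C(Icc (0 : ℝ) T, H)) (s : ℝ) :
    ‖D.gain hT Ψ s‖ ≤ ‖D.B₁‖ + ‖D.B₂‖ * ‖Ψ‖ :=
  (norm_add_le _ _).trans (add_le_add_right (D.B₂.le_opNorm_of_le (Ψ.norm_coe_le_norm _)) _)

lemma gain_sub_gain (Ψ Φ : C(Icc (0 : ℝ) T, H)) (s : ℝ) :
    D.gain hT Ψ s - D.gain hT Φ s = D.B₂ (IccExtend hT.le (Ψ - Φ) s) := by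
  simp [gain, IccExtend]

lemma integrable_smul_gain {u : ℝ → ℝ} (hu : Integrable u (timeMeasure T))
    (Ψ : C(Icc (0 : ℝ) T, H)) : Integrable (fun s => u s • D.gain hT Ψ s) (timeMeasure T) :=
  hu.smul_bdd _ (D.continuous_gain hT Ψ).aestronglyMeasurable
    (Eventually.of_forall (D.norm_gain_le hT Ψ))

variable [CompleteSpace H] (S : C0Semigroup H)

/-- The right-hand side of the state equation in mild form. -/
noncomputable def picard (u : LTime ℝ 1 T) (Ψ : C(Icc (0 : ℝ) T, H)) : C(Icc (0 : ℝ) T, H) :=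
  freeMap S T D.Ψ₀ + duhamelMap S (L1.integrable_coeFn D.f) +
    duhamelMap S (D.integrable_smul_gain hT (L1.integrable_coeFn u) Ψ)

variable {S}

lemma isState_iff (u : LTime ℝ 1 T) (Ψ : C(Icc (0 : ℝ) T, H)) :
    D.IsState hT S u Ψ ↔ D.picard hT S u Ψ = Ψ := by
  rw [eq_comm, ContinuousMap.ext_iff]
  refine forall_congr' fun t => ?_
  rw [mildSolution_eq_duhamel _ _ t.2]
  have h := duhamel_add (S := S) (L1.integrable_coeFn D.f)
    (D.integrable_smul_gain hT (L1.integrable_coeFn u) Ψ) t.2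
  simp only [gain] at h
  rw [h, ← add_assoc]
  rfl

lemma picard_sub_picard (u : LTime ℝ 1 T) (Ψ Φ : C(Icc (0 : ℝ) T, H)) :
    D.picard hT S u Ψ - D.picard hT S u Φ =
      duhamelMap S (D.integrable_smul_gain hT (L1.integrable_coeFn u) Ψ) -
      duhamelMap S (D.integrable_smul_gain hT (L1.integrable_coeFn u) Φ) := by
  rw [picard, picard]; abel

lemma norm_expWeight_picard_sub_le {M : ℝ} (hM0 : 0 ≤ M) (hM : ∀ r x, ‖S.clip T r x‖ ≤ M * ‖x‖)
    {u : LTime ℝ 1 T} {k ε : ℝ} (hε : 0 ≤ ε)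
    (hu : ∀ t ∈ Icc 0 T, ∫ s in (0 : ℝ)..t, |u s| * Real.exp (-(k * (t - s))) ≤ ε)
    (Ψ Φ : C(Icc (0 : ℝ) T, H)) :
    ‖expWeight (-k) (D.picard hT S u Ψ - D.picard hT S u Φ)‖ ≤
      M * ‖D.B₂‖ * ε * ‖expWeight (-k) (Ψ - Φ)‖ := by
  set R := ‖expWeight (-k) (Ψ - Φ)‖ with hR
  have hR0 : 0 ≤ R := norm_nonneg _
  rw [ContinuousMap.norm_le _ (by positivity)]
  intro t
  have h0 : (0 : ℝ) ∈ Icc 0 T := ⟨le_rfl, hT.le⟩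
  have hint := (D.integrable_smul_gain hT (L1.integrable_coeFn u) Ψ).sub
    (D.integrable_smul_gain hT (L1.integrable_coeFn u) Φ)
  have huI := intervalIntegrable_of_timeMeasure (L1.integrable_coeFn u) h0 t.2
  have hpt (s : ℝ) (hs : s ∈ Icc 0 T) : ‖u s • D.gain hT Ψ s - u s • D.gain hT Φ s‖ ≤
      ‖D.B₂‖ * R * (|u s| * Real.exp (k * s)) := by
    rw [← smul_sub, gain_sub_gain, IccExtend_of_mem _ _ hs, norm_smul, Real.norm_eq_abs]
    have h1 : ‖(Ψ - Φ) ⟨s, hs⟩‖ ≤ Real.exp (k * s) * R := by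
      have h2 := ContinuousMap.norm_coe_le_norm (expWeight (-k) (Ψ - Φ)) ⟨s, hs⟩
      rw [expWeight_apply, norm_smul, Real.norm_of_nonneg (Real.exp_pos _).le, neg_mul,
        Real.exp_neg, inv_mul_le_iff₀ (Real.exp_pos _)] at h2
      exact h2
    calc |u s| * ‖D.B₂ ((Ψ - Φ) ⟨s, hs⟩)‖ ≤ |u s| * (‖D.B₂‖ * (Real.exp (k * s) * R)) := by
          gcongr; exact D.B₂.le_opNorm_of_le h1
      _ = _ := by ring
  rw [expWeight_apply, picard_sub_picard, duhamelMap_sub, norm_smul,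
    Real.norm_of_nonneg (Real.exp_pos _).le]
  have hce : Continuous fun s => Real.exp (k * s) := by fun_prop
  calc Real.exp (-k * t) * ‖duhamelMap S hint t‖
      ≤ Real.exp (-k * t) * (M * ∫ s in (0 : ℝ)..t, ‖u s • D.gain hT Ψ s - u s • D.gain hT Φ s‖) := by
        gcongr; exact norm_duhamel_le hM hint t.2
    _ ≤ Real.exp (-k * t) * (M * ∫ s in (0 : ℝ)..t, ‖D.B₂‖ * R * (|u s| * Real.exp (k * s))) := by
        gcongr
        refine intervalIntegral.integral_mono_on t.2.1
          (intervalIntegrable_of_timeMeasure hint h0 t.2).norm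
          ((huI.abs.mul_continuousOn hce.continuousOn).const_mul _) fun s hs =>
            hpt s ⟨hs.1, hs.2.trans t.2.2⟩
    _ = M * ‖D.B₂‖ * R * ∫ s in (0 : ℝ)..t, |u s| * Real.exp (-(k * (t - s))) := by
        rw [intervalIntegral.integral_const_mul]
        have h3 : ∫ s in (0 : ℝ)..t, |u s| * Real.exp (-(k * (t - s))) =
            Real.exp (-k * t) * ∫ s in (0 : ℝ)..t, |u s| * Real.exp (k * s) := by
          rw [← intervalIntegral.integral_const_mul]
          refine intervalIntegral.integral_congr fun s _ => ?_
          rw [mul_left_comm, ← Real.exp_add]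
          congr 2; ring
        rw [h3]; ring
    _ ≤ M * ‖D.B₂‖ * R * ε := by gcongr; exact hu t t.2
    _ = _ := by ring

lemma existsUnique_isState (u : LTime ℝ 1 T) : ∃! Ψ, D.IsState hT S u Ψ := by
  obtain ⟨M, hM0, hM⟩ := S.exists_bound_clip T
  simp only [isState_iff]
  obtain ⟨k, -, hk⟩ := exists_integral_abs_mul_exp_kernel_le (L1.integrable_coeFn u)
    (show 0 < 1 / (2 * (M * ‖D.B₂‖ + 1)) by positivity)
  refine existsUnique_fixedPoint_of_expWeight _ k fun Ψ Φ => ?_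
  refine (D.norm_expWeight_picard_sub_le hT hM0 hM (by positivity) hk Ψ Φ).trans ?_
  gcongr
  rw [mul_one_div, div_le_div_iff₀ (by positivity) two_pos]
  linarith

omit [CompleteSpace H] in
lemma exists_bound_feasible : ∃ U : ℝ, 0 ≤ U ∧ ∀ u ∈ D.feasible,
    ∀ᵐ s ∂(timeMeasure T), |u s| ≤ U := by
  refine ⟨max |D.um| |D.uM|, (abs_nonneg _).trans (le_max_left _ _), fun u hu => ?_⟩
  filter_upwards [hu] with s hs
  exact abs_le_max_abs_abs hs.1 hs.2

omit [CompleteSpace H] in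
lemma ae_norm_smul_gain_le {U : ℝ} (hU0 : 0 ≤ U) {u : ℝ → ℝ}
    (hU : ∀ᵐ s ∂(timeMeasure T), |u s| ≤ U) {R : ℝ} {Ψ : C(Icc (0 : ℝ) T, H)} (hR : ‖Ψ‖ ≤ R) :
    ∀ᵐ s ∂(timeMeasure T), ‖u s • D.gain hT Ψ s‖ ≤ U * (‖D.B₁‖ + ‖D.B₂‖ * R) := by
  filter_upwards [hU] with s hs
  rw [norm_smul]
  have h : ‖D.gain hT Ψ s‖ ≤ ‖D.B₁‖ + ‖D.B₂‖ * R := (D.norm_gain_le hT Ψ s).trans (by gcongr)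
  exact mul_le_mul hs h (norm_nonneg _) hU0

/-- The bound `U` fixes a weight `k` making the Picard map a half-contraction for all feasible
controls at once. Comparing `Ψ` with the Picard image of `0` gives `‖Ψ‖ ≤ ½ ‖Ψ‖ + C` in the weighted
norm. -/
lemma exists_bound_isState : ∃ R : ℝ, ∀ u ∈ D.feasible, ∀ Ψ, D.IsState hT S u Ψ → ‖Ψ‖ ≤ R := by
  obtain ⟨M, hM0, hM⟩ := S.exists_bound_clip T
  obtain ⟨U, hU0, hU⟩ := D.exists_bound_feasible
  set k := 2 * (M * ‖D.B₂‖ * U) + 1 with hk_def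
  have hk : 0 < k := by positivity
  set C := ‖freeMap S T D.Ψ₀‖ + ‖duhamelMap S (L1.integrable_coeFn D.f)‖ +
    M * (T * (U * (‖D.B₁‖ + ‖D.B₂‖ * 0))) with hC
  refine ⟨Real.exp (k * T) * (2 * C), fun u hu Ψ hΨ => ?_⟩
  rw [isState_iff] at hΨ
  have hker : ∀ t ∈ Icc 0 T, ∫ s in (0 : ℝ)..t, |u s| * Real.exp (-(k * (t - s))) ≤ U / k := by
    intro t ht
    have h := integral_abs_mul_exp_kernel_le (L1.integrable_coeFn u)
      (integrable_zero ℝ ℝ (timeMeasure T)) (fun _ => le_rfl) hU0 hk (by simpa using hU u hu) ht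
    simpa using h
  have h1 := D.norm_expWeight_picard_sub_le hT hM0 hM (by positivity) hker Ψ 0
  have h2 : M * ‖D.B₂‖ * (U / k) ≤ 1 / 2 := by
    rw [← mul_div_assoc, div_le_div_iff₀ hk two_pos]
    linarith
  have h3 : ‖D.picard hT S u 0‖ ≤ C := by
    refine norm_add₃_le.trans ?_
    rw [hC]
    gcongr
    refine (norm_duhamelMap_le hM0 hM _).trans ?_
    gcongr
    exact integral_timeMeasure_le hT.le (D.integrable_smul_gain hT (L1.integrable_coeFn u) 0).norm
      (D.ae_norm_smul_gain_le hT hU0 (hU u hu) norm_zero.le)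
  rw [sub_zero, hΨ] at h1
  have h4 : expWeight (-k) Ψ =
      expWeight (-k) (Ψ - D.picard hT S u 0) + expWeight (-k) (D.picard hT S u 0) := by
    ext t; simp [smul_sub]
  have h5 := norm_add_le (expWeight (-k) (Ψ - D.picard hT S u 0))
    (expWeight (-k) (D.picard hT S u 0))
  rw [← h4] at h5
  have h6 := norm_expWeight_neg_le hk.le (D.picard hT S u 0)
  have h7 := mul_le_mul_of_nonneg_right h2 (norm_nonneg (expWeight (-k) Ψ))
  refine (norm_le_exp_mul_norm_expWeight_neg hk.le Ψ).trans ?_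
  gcongr
  linarith

/-- The source `f` is only `L¹`, but it contributes one fixed function. Only the control term
varies, and it is uniformly bounded, hence bounded in `L²`. -/
lemma exists_isCompact_isState_mem
    (hS : ∀ t, 0 < t → ∀ R, IsCompact (closure (S.toFun t '' Metric.ball 0 R))) :
    ∃ K : Set C(Icc (0 : ℝ) T, H), IsCompact K ∧
      ∀ u ∈ D.feasible, ∀ Ψ, D.IsState hT S u Ψ → Ψ ∈ K := by
  obtain ⟨U, hU0, hU⟩ := D.exists_bound_feasible
  obtain ⟨R, hR⟩ := D.exists_bound_isState hT (S := S)
  set C := U * (‖D.B₁‖ + ‖D.B₂‖ * R) with hC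
  obtain ⟨K, hK, hmem⟩ := exists_isCompact_duhamelMap_mem hS hT.le
    (show 0 ≤ T * C ^ 2 by positivity)
  refine ⟨(fun Φ => freeMap S T D.Ψ₀ + duhamelMap S (L1.integrable_coeFn D.f) + Φ) '' K,
    hK.image (continuous_const.add continuous_id), fun u hu Ψ hΨ => ?_⟩
  have hb := D.ae_norm_smul_gain_le hT hU0 (hU u hu) (hR u hu Ψ hΨ)
  have hint := D.integrable_smul_gain hT (L1.integrable_coeFn u) Ψ
  have h2 : MemLp (fun s => u s • D.gain hT Ψ s) 2 (timeMeasure T) := MemLp.of_bound hint.1 C hb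
  refine ⟨_, hmem _ hint h2 (integral_timeMeasure_le hT.le (h2.integrable_norm_pow two_ne_zero) ?_),
    (D.isState_iff hT u Ψ).1 hΨ⟩
  filter_upwards [hb] with s hs
  gcongr

end ProblemData

end State

/-! ### Weak compactness of the set of controls -/

section WeakLimit

variable {T : ℝ}

lemma integral_mul_indicator_one {s : Set ℝ} (hs : MeasurableSet s) (u : ℝ → ℝ) :
    ∫ x, u x * s.indicator (fun _ => 1) x ∂(timeMeasure T) = ∫ x in s, u x ∂(timeMeasure T) := by
  rw [← integral_indicator hs]
  refine integral_congr_ae (Eventually.of_forall fun x => ?_)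
  by_cases hx : x ∈ s <;> simp [hx]

/-- Banach-Alaoglu in the Hilbert space `L²`, where controls with values in `[a, b]` are bounded.
Testing against indicators shows that the limit obeys the same pointwise bounds. -/
lemma exists_weak_limit (𝒰 : Ultrafilter (LTime ℝ 1 T)) {a b : ℝ}
    (h𝒰 : {u : LTime ℝ 1 T | ∀ᵐ t ∂(timeMeasure T), a ≤ u t ∧ u t ≤ b} ∈ 𝒰) :
    ∃ v : LTime ℝ 1 T, (∀ᵐ t ∂(timeMeasure T), a ≤ v t ∧ v t ≤ b) ∧
      ∀ φ : ℝ → ℝ, MemLp φ 2 (timeMeasure T) →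
        Tendsto (fun u : LTime ℝ 1 T => ∫ t, u t * φ t ∂(timeMeasure T)) 𝒰
          (𝓝 (∫ t, v t * φ t ∂(timeMeasure T))) := by
  classical
  let j : LTime ℝ 1 T → LTime ℝ 2 T :=
    fun u => if h : MemLp u 2 (timeMeasure T) then h.toLp else 0
  have hbound {u : LTime ℝ 1 T} (hu : ∀ᵐ t ∂(timeMeasure T), a ≤ u t ∧ u t ≤ b) :
      ∀ᵐ t ∂(timeMeasure T), ‖u t‖ ≤ max |a| |b| := by
    filter_upwards [hu] with t ht
    exact abs_le_max_abs_abs ht.1 ht.2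
  have hj {u : LTime ℝ 1 T} (hu : ∀ᵐ t ∂(timeMeasure T), a ≤ u t ∧ u t ≤ b) :
      j u =ᵐ[timeMeasure T] u := by
    have h : MemLp u 2 (timeMeasure T) := MemLp.of_bound (Lp.aestronglyMeasurable u) _ (hbound hu)
    simp only [j, dif_pos h]
    exact h.coeFn_toLp
  set C := (measureUnivNNReal (timeMeasure T) : ℝ) ^ (2 : ℝ≥0∞).toReal⁻¹ * max |a| |b| with hC
  have hjC {u : LTime ℝ 1 T} (hu : ∀ᵐ t ∂(timeMeasure T), a ≤ u t ∧ u t ≤ b) : ‖j u‖ ≤ C := by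
    refine Lp.norm_le_of_ae_bound ((abs_nonneg a).trans (le_max_left _ _)) ?_
    filter_upwards [hj hu, hbound hu] with t h1 h2
    rwa [h1]
  let J : LTime ℝ 1 T → WeakDual ℝ (LTime ℝ 2 T) :=
    fun u => StrongDual.toWeakDual (InnerProductSpace.toDual ℝ _ (j u))
  obtain ⟨l, -, hl⟩ := isCompact_iff_ultrafilter_le_nhds'.1
    (WeakDual.isCompact_closedBall (𝕜 := ℝ) (0 : StrongDual ℝ (LTime ℝ 2 T)) C) (𝒰.map J) (by
      rw [Ultrafilter.mem_map]
      filter_upwards [h𝒰] with u hu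
      change InnerProductSpace.toDual ℝ _ (j u) ∈ Metric.closedBall 0 C
      rw [mem_closedBall_zero_iff, LinearIsometryEquiv.norm_map]
      exact hjC hu)
  set w : LTime ℝ 2 T := (InnerProductSpace.toDual ℝ _).symm (WeakDual.toStrongDual l) with hw
  have hw1 : MemLp w 1 (timeMeasure T) := (Lp.memLp w).mono_exponent (by norm_num)
  obtain ⟨v, hvw⟩ : ∃ v : LTime ℝ 1 T, v =ᵐ[timeMeasure T] w := ⟨hw1.toLp, hw1.coeFn_toLp⟩
  have hlim (φ : ℝ → ℝ) (hφ : MemLp φ 2 (timeMeasure T)) :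
      Tendsto (fun u : LTime ℝ 1 T => ∫ t, u t * φ t ∂(timeMeasure T)) 𝒰
        (𝓝 (∫ t, v t * φ t ∂(timeMeasure T))) := by
    have h1 : Tendsto (fun u => J u hφ.toLp) 𝒰 (𝓝 (l hφ.toLp)) :=
      ((WeakDual.eval_continuous hφ.toLp).tendsto l).comp hl
    have h2 : l hφ.toLp = ∫ t, v t * φ t ∂(timeMeasure T) := by
      have h3 : l hφ.toLp = inner ℝ w hφ.toLp := by
        rw [hw, InnerProductSpace.toDual_symm_apply]; rfl
      rw [h3, L2.inner_def]
      refine integral_congr_ae ?_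
      filter_upwards [hvw, hφ.coeFn_toLp] with t e1 e2
      rw [e1, e2]; simp [mul_comm]
    rw [← h2]
    refine h1.congr' ?_
    filter_upwards [h𝒰] with u hu
    change inner ℝ (j u) hφ.toLp = _
    rw [L2.inner_def]
    refine integral_congr_ae ?_
    filter_upwards [hj hu, hφ.coeFn_toLp] with t e1 e2
    rw [e1, e2]; simp [mul_comm]
  refine ⟨v, ?_, hlim⟩
  have hset {s : Set ℝ} (hs : MeasurableSet s) :
      Tendsto (fun u : LTime ℝ 1 T => ∫ t in s, u t ∂(timeMeasure T)) 𝒰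
        (𝓝 (∫ t in s, v t ∂(timeMeasure T))) := by
    simpa only [integral_mul_indicator_one hs] using
      hlim (s.indicator fun _ => 1) ((memLp_const 1).indicator hs)
  have hlow : ∀ᵐ t ∂(timeMeasure T), a ≤ v t := by
    refine ae_le_of_forall_setIntegral_le (integrable_const a) (L1.integrable_coeFn _)
      fun s hs _ => ge_of_tendsto (hset hs) ?_
    filter_upwards [h𝒰] with u hu
    exact integral_mono_ae (integrable_const a) (L1.integrable_coeFn u).integrableOn
      (ae_restrict_of_ae (hu.mono fun t ht => ht.1))
  have hupp : ∀ᵐ t ∂(timeMeasure T), v t ≤ b := by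
    refine ae_le_of_forall_setIntegral_le (L1.integrable_coeFn _) (integrable_const b)
      fun s hs _ => le_of_tendsto (hset hs) ?_
    filter_upwards [h𝒰] with u hu
    exact integral_mono_ae (L1.integrable_coeFn u).integrableOn (integrable_const b)
      (ae_restrict_of_ae (hu.mono fun t ht => ht.2))
  exact hlow.and hupp

end WeakLimit

/-! ### Existence of a minimum -/

section Minimum

variable {T : ℝ} {H : Type*} [NormedAddCommGroup H] [InnerProductSpace ℝ H]

namespace ProblemData

variable (D : ProblemData H T) (hT : 0 < T)

lemma exists_bound_target : ∃ C : ℝ, ∀ᵐ t ∂(timeMeasure T), ‖D.Ψd t‖ ≤ C := by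
  have h := (Lp.memLp D.Ψd).2
  rw [eLpNorm_exponent_top] at h
  refine ⟨(eLpNormEssSup D.Ψd (timeMeasure T)).toReal, ?_⟩
  filter_upwards [ae_le_eLpNormEssSup (f := D.Ψd) (μ := timeMeasure T)] with t ht
  rw [← toReal_enorm]
  exact ENNReal.toReal_mono h.ne ht

lemma continuous_runningCost : Continuous fun Ψ : C(Icc (0 : ℝ) T, H) =>
    ∫ t, D.Q (IccExtend hT.le Ψ t - D.Ψd t) (IccExtend hT.le Ψ t - D.Ψd t) ∂(timeMeasure T) := by
  obtain ⟨C, hC⟩ := D.exists_bound_target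
  have hQ : Continuous fun x => D.Q x x := D.Q.continuous.clm_apply continuous_id
  rw [continuous_iff_continuousAt]
  intro Ψ₀
  refine continuousAt_of_dominated
    (bound := fun _ => ‖D.Q‖ * (‖Ψ₀‖ + 1 + C) * (‖Ψ₀‖ + 1 + C))
    (Eventually.of_forall fun Ψ => ?_) ?_ (integrable_const _)
    (Eventually.of_forall fun t => ?_)
  · exact hQ.comp_aestronglyMeasurable (Ψ.continuous.Icc_extend'.aestronglyMeasurable.sub
      (Lp.aestronglyMeasurable D.Ψd))
  · filter_upwards [Metric.ball_mem_nhds Ψ₀ one_pos] with Ψ hΨ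
    filter_upwards [hC] with t ht
    have h1 : ‖IccExtend hT.le Ψ t - D.Ψd t‖ ≤ ‖Ψ₀‖ + 1 + C := by
      refine (norm_sub_le _ _).trans (add_le_add ?_ ht)
      refine (Ψ.norm_coe_le_norm (projIcc 0 T hT.le t)).trans ?_
      rw [Metric.mem_ball, dist_eq_norm] at hΨ
      linarith [norm_le_norm_add_norm_sub' Ψ Ψ₀]
    refine (D.Q.le_opNorm₂ _ _).trans ?_
    have h2 := (norm_nonneg _).trans h1
    gcongr
  · have h : Continuous fun Ψ : C(Icc (0 : ℝ) T, H) => IccExtend hT.le Ψ t - D.Ψd t :=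
      (continuous_eval_const (projIcc 0 T hT.le t)).sub continuous_const
    exact (hQ.comp h).continuousAt

lemma continuous_finalCost : Continuous fun Ψ : C(Icc (0 : ℝ) T, H) =>
    D.QT (IccExtend hT.le Ψ T - D.ΨdT) (IccExtend hT.le Ψ T - D.ΨdT) := by
  have hQ : Continuous fun x => D.QT x x := D.QT.continuous.clm_apply continuous_id
  exact hQ.comp ((continuous_eval_const (projIcc 0 T hT.le T)).sub continuous_const)

variable [CompleteSpace H] {S : C0Semigroup H}

/-- For fixed `Ψ`, each scalar component of the control term is the pairing of `u` with a fixed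
kernel, the form in which weak convergence applies. -/
lemma inner_duhamel_smul {u : ℝ → ℝ} (hu : Integrable u (timeMeasure T))
    (Ψ : C(Icc (0 : ℝ) T, H)) {t : ℝ} (ht : t ∈ Icc 0 T) (h : H) :
    inner ℝ h (duhamel S T (fun s => u s • D.gain hT Ψ s) t) =
      ∫ s, u s * (Ioc 0 t).indicator (fun s => inner ℝ h (S.clip T (t - s) (D.gain hT Ψ s))) s
        ∂(timeMeasure T) := by
  have h1 := (innerSL ℝ h).intervalIntegral_comp_comm
    (intervalIntegrable_clip_apply (S := S) (D.integrable_smul_gain hT hu Ψ) ⟨le_rfl, hT.le⟩ ht t)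
  rw [duhamel]
  refine Eq.trans h1.symm ?_
  have h2 : Ioc 0 t ⊆ Icc 0 T := Ioc_subset_Icc_self.trans (Icc_subset_Icc le_rfl ht.2)
  rw [intervalIntegral.integral_of_le ht.1, ← inter_eq_left.2 h2,
    ← Measure.restrict_restrict measurableSet_Ioc, ← integral_indicator measurableSet_Ioc]
  rw [inter_eq_left.2 h2]
  refine integral_congr_ae (Eventually.of_forall fun s => ?_)
  by_cases hs : s ∈ Ioc 0 t
  · simp only [indicator_of_mem hs, map_smul, innerSL_apply_apply, smul_eq_mul]
  · simp only [indicator_of_notMem hs, mul_zero]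

lemma memLp_indicator_inner_clip (Ψ : C(Icc (0 : ℝ) T, H)) (t : ℝ) (h : H) :
    MemLp ((Ioc 0 t).indicator fun s => inner ℝ h (S.clip T (t - s) (D.gain hT Ψ s))) 2
      (timeMeasure T) := by
  obtain ⟨M, hM0, hM⟩ := S.exists_bound_clip T
  refine MemLp.indicator measurableSet_Ioc (MemLp.of_bound ?_
    (‖h‖ * (M * (‖D.B₁‖ + ‖D.B₂‖ * ‖Ψ‖))) (Eventually.of_forall fun s => ?_))
  · have hc : Continuous fun s => S.clip T (t - s) (D.gain hT Ψ s) :=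
      (S.continuous_clip_uncurry T).comp
        ((continuous_const.sub continuous_id).prodMk (D.continuous_gain hT Ψ))
    exact (continuous_const.inner hc).aestronglyMeasurable
  · refine (norm_inner_le_norm _ _).trans ?_
    gcongr
    refine (hM _ _).trans ?_
    gcongr
    exact D.norm_gain_le hT Ψ s

lemma norm_duhamelMap_smul_gain_sub_le {M U : ℝ} (hM0 : 0 ≤ M)
    (hM : ∀ r x, ‖S.clip T r x‖ ≤ M * ‖x‖) {u : ℝ → ℝ}
    (hu : Integrable u (timeMeasure T)) (hU0 : 0 ≤ U) (hU : ∀ᵐ s ∂(timeMeasure T), |u s| ≤ U)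
    (Ψ Φ : C(Icc (0 : ℝ) T, H)) :
    ‖duhamelMap S (D.integrable_smul_gain hT hu Ψ) -
      duhamelMap S (D.integrable_smul_gain hT hu Φ)‖ ≤ M * (T * (U * (‖D.B₂‖ * ‖Ψ - Φ‖))) := by
  refine (norm_duhamelMap_sub_le hM0 hM _ _).trans ?_
  gcongr
  refine integral_timeMeasure_le hT.le
    ((D.integrable_smul_gain hT hu Ψ).sub (D.integrable_smul_gain hT hu Φ)).norm ?_
  filter_upwards [hU] with s hs
  change ‖u s • D.gain hT Ψ s - u s • D.gain hT Φ s‖ ≤ _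
  rw [← smul_sub, gain_sub_gain, norm_smul]
  exact mul_le_mul hs (D.B₂.le_opNorm_of_le ((Ψ - Φ).norm_coe_le_norm (projIcc 0 T hT.le s)))
    (norm_nonneg _) hU0

/-- In the product of control and state, replacing the state by its uniform limit `Φ` costs an error
tending to zero, as controls are bounded. With `Φ` frozen the Picard map is affine in `u`, so its
components pass to the weak limit. -/
lemma isState_of_tendsto {𝒰 : Filter (LTime ℝ 1 T)} [𝒰.NeBot] (h𝒰 : D.feasible ∈ 𝒰)
    {Ψ : LTime ℝ 1 T → C(Icc (0 : ℝ) T, H)} (hΨ : ∀ u, D.IsState hT S u (Ψ u))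
    {v : LTime ℝ 1 T} (hv : ∀ φ : ℝ → ℝ, MemLp φ 2 (timeMeasure T) →
      Tendsto (fun u : LTime ℝ 1 T => ∫ t, u t * φ t ∂(timeMeasure T)) 𝒰
        (𝓝 (∫ t, v t * φ t ∂(timeMeasure T))))
    {Φ : C(Icc (0 : ℝ) T, H)} (hΦ : Tendsto Ψ 𝒰 (𝓝 Φ)) : D.IsState hT S v Φ := by
  obtain ⟨M, hM0, hM⟩ := S.exists_bound_clip T
  obtain ⟨U, hU0, hU⟩ := D.exists_bound_feasible
  have hdiff : Tendsto (fun u : LTime ℝ 1 T =>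
      duhamelMap S (D.integrable_smul_gain hT (L1.integrable_coeFn u) (Ψ u)) -
      duhamelMap S (D.integrable_smul_gain hT (L1.integrable_coeFn u) Φ)) 𝒰 (𝓝 0) := by
    have h1 : Tendsto (fun u => M * (T * (U * (‖D.B₂‖ * ‖Ψ u - Φ‖)))) 𝒰 (𝓝 0) := by
      simpa using ((((tendsto_iff_norm_sub_tendsto_zero.1 hΦ).const_mul ‖D.B₂‖).const_mul
        U).const_mul T).const_mul M
    refine squeeze_zero_norm' ?_ h1
    filter_upwards [h𝒰] with u hu
    exact D.norm_duhamelMap_smul_gain_sub_le hT hM0 hM (L1.integrable_coeFn u) hU0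
      (hU u hu) _ _
  have hpic : Tendsto (fun u => D.picard hT S u Φ) 𝒰 (𝓝 Φ) := by
    have h1 := hΦ.sub hdiff
    rw [sub_zero] at h1
    refine h1.congr fun u => ?_
    rw [← picard_sub_picard, (D.isState_iff hT u (Ψ u)).1 (hΨ u), sub_sub_cancel]
  rw [isState_iff]
  ext t
  refine ext_inner_left ℝ fun h => ?_
  have h1 : Tendsto (fun u => inner ℝ h (D.picard hT S u Φ t)) 𝒰 (𝓝 (inner ℝ h (Φ t))) :=
    tendsto_const_nhds.inner (((continuous_eval_const t).tendsto Φ).comp hpic)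
  refine tendsto_nhds_unique ?_ h1
  have h2 (u : LTime ℝ 1 T) : inner ℝ h (D.picard hT S u Φ t) =
      inner ℝ h (S.clip T t D.Ψ₀ + duhamel S T D.f t) +
      ∫ s, u s * (Ioc 0 (t : ℝ)).indicator
        (fun s => inner ℝ h (S.clip T (t - s) (D.gain hT Φ s))) s ∂(timeMeasure T) := by
    rw [← D.inner_duhamel_smul hT (L1.integrable_coeFn u) Φ t.2 h, ← inner_add_right]
    rfl
  simp only [h2]
  exact tendsto_const_nhds.add (hv _ (D.memLp_indicator_inner_clip hT Φ t h))

omit [CompleteSpace H] in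
lemma tendsto_cost {𝒰 : Filter (LTime ℝ 1 T)} {Ψ : LTime ℝ 1 T → C(Icc (0 : ℝ) T, H)}
    {v : LTime ℝ 1 T} (hv : ∀ φ : ℝ → ℝ, MemLp φ 2 (timeMeasure T) →
      Tendsto (fun u : LTime ℝ 1 T => ∫ t, u t * φ t ∂(timeMeasure T)) 𝒰
        (𝓝 (∫ t, v t * φ t ∂(timeMeasure T))))
    {Φ : C(Icc (0 : ℝ) T, H)} (hΦ : Tendsto Ψ 𝒰 (𝓝 Φ)) :
    Tendsto (fun u => D.cost hT u (Ψ u)) 𝒰 (𝓝 (D.cost hT v Φ)) := by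
  have h1 := hv (fun _ => 1) (memLp_const 1)
  simp only [mul_one] at h1
  exact ((h1.const_mul D.α).add ((((D.continuous_runningCost hT).tendsto Φ).comp hΦ).const_mul
    (1 / 2))).add ((((D.continuous_finalCost hT).tendsto Φ).comp hΦ).const_mul (1 / 2))

lemma feasible_nonempty {H : Type*} [NormedAddCommGroup H] [InnerProductSpace ℝ H]
    (D : ProblemData H T) : D.feasible.Nonempty := by
  have h : MemLp (fun _ : ℝ => D.um) 1 (timeMeasure T) := memLp_const _
  refine ⟨h.toLp, ?_⟩
  filter_upwards [h.coeFn_toLp] with t ht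
  rw [ht]
  exact ⟨le_rfl, D.um_lt_uM.le⟩

theorem hasMinimum_of_isCompact
    (hS : ∀ t, 0 < t → ∀ R, IsCompact (closure (S.toFun t '' Metric.ball 0 R))) :
    D.HasMinimum hT S := by
  choose stateMap hstate hunique using fun u => (D.existsUnique_isState hT (S := S) u)
  refine ⟨stateMap, fun u Ψ => ⟨hunique u Ψ, fun h => h ▸ hstate u⟩, ?_⟩
  have hcompact : IsCompact ((fun u => D.cost hT u (stateMap u)) '' D.feasible) := by
    rw [isCompact_iff_ultrafilter_le_nhds']
    intro 𝒱 h𝒱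
    -- The ultrafilter of cost values is lifted to one of feasible controls, along which controls
    -- and states both converge. Uniqueness of the state identifies the limit of the states as the
    -- state of the limit control.
    set 𝒰 := Ultrafilter.ofComapInfPrincipal h𝒱
    have h𝒰 : D.feasible ∈ 𝒰 := Ultrafilter.ofComapInfPrincipal_mem h𝒱
    obtain ⟨v, hvf, hv⟩ := exists_weak_limit 𝒰 h𝒰
    obtain ⟨K, hK, hKmem⟩ := D.exists_isCompact_isState_mem hT hS
    obtain ⟨Φ, -, hΦ⟩ := isCompact_iff_ultrafilter_le_nhds'.1 hK (𝒰.map stateMap) (by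
      rw [Ultrafilter.mem_map]
      filter_upwards [h𝒰] with u hu
      exact hKmem u hu _ (hstate u))
    have hΦv : Φ = stateMap v := hunique v Φ (D.isState_of_tendsto hT h𝒰 hstate hv hΦ)
    refine ⟨_, ⟨v, hvf, rfl⟩, ?_⟩
    rw [← Ultrafilter.ofComapInfPrincipal_eq_of_map h𝒱]
    have := D.tendsto_cost hT hv hΦ
    rwa [hΦv] at this
  obtain ⟨_, ⟨v, hvf, rfl⟩, hmin⟩ := hcompact.exists_isLeast (D.feasible_nonempty.image _)
  exact ⟨v, hvf, fun u hu => hmin ⟨u, hu, rfl⟩⟩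

end ProblemData

end Minimum

end ParabolicControl

theorem mainTheorem10
    {H V : Type*}
    [NormedAddCommGroup H] [InnerProductSpace ℝ H] [CompleteSpace H]
    [NormedAddCommGroup V] [InnerProductSpace ℝ V] [CompleteSpace V]
    (ι : V →L[ℝ] H) (hι : ParabolicControl.IsDenseCompactEmbedding ι)
    (a : V →L[ℝ] V →L[ℝ] ℝ) (ha : ParabolicControl.IsSemicoercive ι a)
    {T : ℝ} (hT : 0 < T) (D : ParabolicControl.ProblemData H T) :
    (∃ S : ParabolicControl.C0Semigroup H,
      S.IsGeneratedByNeg (ParabolicControl.FormOperatorGraph ι a)) ∧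
    ∀ S : ParabolicControl.C0Semigroup H,
      S.IsGeneratedByNeg (ParabolicControl.FormOperatorGraph ι a) →
        ParabolicControl.CompactnessHypothesis S D.B₂ T ∧ D.HasMinimum hT S := by
  refine ⟨ParabolicControl.exists_c0Semigroup_of_semicoercive hι.denseRange ha, fun S hS => ?_⟩
  have hcompact (t : ℝ) (ht : 0 < t) (R : ℝ) :=
    ParabolicControl.isCompact_closure_image_semigroup hι ha hS ht R
  exact ⟨ParabolicControl.compactnessHypothesis_of_isCompact hcompact hT.le D.B₂,
    D.hasMinimum_of_isCompact hT hcompact⟩
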